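/- Theorem 1 (Network stability). Consider a strongly connected network of $N$ agents (every agent can be reached from every other one, and there is at least one self-loop), where $\mathcal N_k$ denotes the neighborhood of agent $k$. Let $A_1=[a_{1,\ell k}]$ and $A_2=[a_{2,\ell k}]$ be left-stochastic combination matrices over the network: $a_{j,\ell k}\ge 0$, $\sum_{\ell} a_{j,\ell k}=1$, and $a_{j,\ell k}=0$ if $\ell\notin\mathcal N_k$. Assume that $P=A_1A_2$ is primitive. Let the costs $J_k:\mathbb R^M\to\mathbb R$ be twice differentiable with $$0<\nu_d I_M\le \nabla^2 J_k(w)\le \delta_d I_M\qquad\text{for all } w\in\mathbb R^M,\ k=1,\dots,N,$$ and with a common minimizer $w^o$. Let $0\le r_k<1$, $\beta_k\ge0$, $\sigma_{s,k}\ge 0$. Starting from random initial conditions $w_{k,-1}$ with finite fourth-order moments, and with step-sizes $\mu_k>0$, the agents run, for $i\ge0$, $$\phi_{k,i-1}=\sum_{\ell\in\mathcal N_k}a_{1,\ell k}w_{\ell,i-1},\qquad \psi_{k,i}=\phi_{k,i-1}-\mu_k\Gamma_{k,i}\,\widehat{\nabla J}_{k,i}(\phi_{k,i-1}),\qquad w_{k,i}=\sum_{\ell\in\mathcal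 N_k}a_{2,\ell k}\psi_{\ell,i},$$ where $\widehat{\nabla J}_{k,i}(\cdot)$ is a random approximation of the gradient of $J_k$ and $\Gamma_{k,i}=\mathrm{diag}\{r_{k,i}(1),\dots,r_{k,i}(M)\}$. Let $\mathcal F_{i-1}$ be the $\sigma$-algebra generated by the iterates $w_{k,j}$ and the $\Gamma_{k,j}$ of all agents up to time $i-1$, and let $s_{k,i}(w)=\widehat{\nabla J}_{k,i}(w)-\nabla J_k(w)$. Assume that for all $i$: (a) each $r_{k,i}(m)$ takes the values $0$ and $1$, with $\mathrm{Prob}(r_{k,i}(m)=0)=r_k$; the variables $r_{k,i}(m)$ of iteration $i$ are (pairwise) independent of each other over all agents $k$ and coordinates $m$; and, as a family, they are independent of $\mathcal F_{i-1}$ together with $\widehat{\nabla J}_{k,i}(w)$, for every agent $k$ and every $\mathcal F_{i-1}$-measurable $w$ with finite fourth-order moment; (b) for every $\mathcal F_{i-1}$-measurable $w$ with finite fourth-order moment and all agents $k\ne\ell$, almost surely, $$\mathbb E[s_{k,i}(w)\mid\mathcal F_{i-1}]=0,\qquad \mathbb E[s_{k,i}(w)s_{\ell,i}(w)^{\mathsf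 T}\mid\mathcal F_{i-1}]=0,$$ and, for every agent $k$, $$\mathbb E[\|s_{k,i}(w)\|^4\mid\mathcal F_{i-1}]\le\beta_k^4\|w\|^4+\sigma_{s,k}^4 .$$ Let $\mu_{\max}=\max_k\mu_k$ and $\widetilde w_{k,i}=w^o-w_{k,i}$. Then there are constants $C,\mu_o>0$, depending only on the network, $A_1$, $A_2$, the costs $J_k$ (with $w^o,\nu_d,\delta_d$) and the parameters $r_k,\beta_k,\sigma_{s,k}$, such that whenever $\mu_{\max}<\mu_o$, for all $k=1,\dots,N$, $$\limsup_{i\to\infty}\mathbb E\|\widetilde w_{k,i}\|^2\le C\mu_{\max},\qquad \limsup_{i\to\infty}\mathbb E\|\widetilde w_{k,i}\|^4\le C\mu_{\max}^2 .$$ -/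

import Mathlib

open MeasureTheory ProbabilityTheory Filter
open scoped BigOperators ENNReal

noncomputable section

namespace CoordDiffusion

/-- The parameter space `ℝ^M` with the Euclidean norm. -/
abbrev Vec (M : ℕ) : Type := EuclideanSpace ℝ (Fin M)

/-- `nbr k` is the neighborhood of agent `k`. The network is strongly connected if every agent can
be reached from every agent and the topology has at least one self-loop. -/
structure IsStronglyConnected {N : ℕ} (nbr : Fin N → Finset (Fin N)) : Prop where
  path : ∀ k l : Fin N, Relation.ReflTransGen (fun a b => a ∈ nbr b) k l
  selfLoop : ∃ k : Fin N, k ∈ nbr k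

/-- A left-stochastic combination matrix `A = [a_{lk}]` over the network: nonnegative entries,
columns adding up to one, and `a_{lk} = 0` if `l` is not a neighbor of `k`. -/
structure IsCombinationMatrix {N : ℕ} (nbr : Fin N → Finset (Fin N))
    (A : Matrix (Fin N) (Fin N) ℝ) : Prop where
  nonneg : ∀ l k, 0 ≤ A l k
  col_sum : ∀ k, ∑ l, A l k = 1
  support : ∀ l k, l ∉ nbr k → A l k = 0

/-- `J` is twice differentiable and `ν I ≤ ∇² J(w) ≤ δ I` for all `w`, where the Hessian is the
derivative of the gradient and `≤` is the Loewner order on operators. -/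
structure HasHessianBounds {M : ℕ} (ν δ : ℝ) (J : Vec M → ℝ) : Prop where
  differentiable : Differentiable ℝ J
  differentiable_gradient : Differentiable ℝ (gradient J)
  lower : ∀ w : Vec M, ν • ContinuousLinearMap.id ℝ (Vec M) ≤ fderiv ℝ (gradient J) w
  upper : ∀ w : Vec M, fderiv ℝ (gradient J) w ≤ δ • ContinuousLinearMap.id ℝ (Vec M)

/-- The combination step `∑_{l ∈ N_k} a_{lk} w_l`. -/
def combine {N M : ℕ} (nbr : Fin N → Finset (Fin N)) (A : Matrix (Fin N) (Fin N) ℝ)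
    (w : Fin N → Vec M) (k : Fin N) : Vec M :=
  ∑ l ∈ nbr k, A l k • w l

/-- The product `Γ v` with the diagonal matrix `Γ = diag{r(1), …, r(M)}`. -/
def mask {M : ℕ} (r : Fin M → ℝ) (v : Vec M) : Vec M :=
  WithLp.toLp 2 (Matrix.mulVec (Matrix.diagonal r) (WithLp.ofLp v))

/-- The random objects that drive the algorithm, on a sample space `Ω`. -/
structure Inputs (N M : ℕ) (Ω : Type*) where
  /-- `init k` is the initial condition `w_{k,-1}` of agent `k`. -/
  init : Fin N → Ω → Vec M
  /-- `approxGrad k i w` is the approximate gradient of `J_k` at `w` used at iteration `i`. -/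
  approxGrad : Fin N → ℕ → Vec M → Ω → Vec M
  /-- `indicator k i m` is the indicator variable `r_{k,i}(m)`. -/
  indicator : Fin N → ℕ → Fin M → Ω → ℝ

section Algorithm

variable {N M : ℕ} {Ω : Type*}

/-- The iterates of coordinate-descent diffusion. The time index is shifted by one:
`iterate nbr A₁ A₂ μ D i k` is `w_{k,i-1}`, so that `i = 0` gives the initial condition. -/
def iterate (nbr : Fin N → Finset (Fin N)) (A₁ A₂ : Matrix (Fin N) (Fin N) ℝ) (μ : Fin N → ℝ)
    (D : Inputs N M Ω) : ℕ → Fin N → Ω → Vec M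
  | 0 => D.init
  | i + 1 => fun k ω =>
      let φ : Fin N → Vec M := combine nbr A₁ (fun l => iterate nbr A₁ A₂ μ D i l ω)
      let ψ : Fin N → Vec M := fun l =>
        φ l - μ l • mask (fun m => D.indicator l i m ω) (D.approxGrad l i (φ l) ω)
      combine nbr A₂ ψ k

/-- The σ-algebra `F_{i-1}` generated by `w_{k,j}` (`-1 ≤ j ≤ i-1`) and `r_{k,j}(m)`
(`0 ≤ j ≤ i-1`), for all agents `k` and coordinates `m`. -/
def past (nbr : Fin N → Finset (Fin N)) (A₁ A₂ : Matrix (Fin N) (Fin N) ℝ) (μ : Fin N → ℝ)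
    (D : Inputs N M Ω) (i : ℕ) : MeasurableSpace Ω :=
  (⨆ (j : ℕ) (_ : j ≤ i) (k : Fin N),
      MeasurableSpace.comap (iterate nbr A₁ A₂ μ D j k) inferInstance) ⊔
    ⨆ (j : ℕ) (_ : j < i) (k : Fin N) (m : Fin M),
      MeasurableSpace.comap (D.indicator k j m) inferInstance

/-- The gradient noise `s_{k,i}(w)` at a random point `w`. -/
def gradNoise (J : Fin N → Vec M → ℝ) (D : Inputs N M Ω) (k : Fin N) (i : ℕ)
    (w : Ω → Vec M) (ω : Ω) : Vec M :=
  D.approxGrad k i (w ω) ω - gradient (J k) (w ω)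

/-- `w` is an admissible random point for the σ-algebra `F`: it is `F`-measurable and has a finite
fourth-order moment. -/
structure IsIterate [MeasurableSpace Ω] (P : Measure Ω) (F : MeasurableSpace Ω)
    (w : Ω → Vec M) : Prop where
  measurable : Measurable[F] w
  memLp : MemLp w 4 P

/-- Measurability of all random objects, and finite fourth-order moments of the initial
conditions. -/
structure IsRegular [MeasurableSpace Ω] (P : Measure Ω) (D : Inputs N M Ω) : Prop where
  measurable_init : ∀ k, Measurable (D.init k)
  memLp_init : ∀ k, MemLp (D.init k) 4 P
  measurable_approxGrad : ∀ k i, Measurable (fun p : Vec M × Ω => D.approxGrad k i p.1 p.2)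
  measurable_indicator : ∀ k i m, Measurable (D.indicator k i m)

/-- Conditions on the indicator variables: each `r_{k,i}(m)` is zero (with probability `r k`) or
one, those of one iteration are independent of each other, and together they are independent of the
past and of the approximate gradients at points determined by the past. -/
structure IndicatorConditions [MeasurableSpace Ω] (P : Measure Ω) (r : Fin N → ℝ)
    (F : ℕ → MeasurableSpace Ω) (D : Inputs N M Ω) : Prop where
  zero_or_one : ∀ k i m ω, D.indicator k i m ω = 0 ∨ D.indicator k i m ω = 1
  prob_zero : ∀ k i m, P {ω | D.indicator k i m ω = 0} = ENNReal.ofReal (r k)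
  indep : ∀ i, Pairwise fun a b : Fin N × Fin M =>
    IndepFun (D.indicator a.1 i a.2) (D.indicator b.1 i b.2) P
  indep_past : ∀ (i : ℕ) (k : Fin N) (w : Ω → Vec M), IsIterate P (F i) w →
    Indep
      (⨆ (l : Fin N) (m : Fin M), MeasurableSpace.comap (D.indicator l i m) inferInstance)
      (F i ⊔ MeasurableSpace.comap (fun ω => D.approxGrad k i (w ω) ω) inferInstance) P

/-- Conditions on the gradient noise: zero conditional mean, conditionally uncorrelated across
agents, and a bound on the conditional fourth-order moment. -/
structure NoiseConditions [MeasurableSpace Ω] (P : Measure Ω) (J : Fin N → Vec M → ℝ)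
    (β σ : Fin N → ℝ) (F : ℕ → MeasurableSpace Ω) (D : Inputs N M Ω) : Prop where
  memLp : ∀ (i : ℕ) (k : Fin N) (w : Ω → Vec M), IsIterate P (F i) w →
    MemLp (gradNoise J D k i w) 4 P
  mean_zero : ∀ (i : ℕ) (k : Fin N) (w : Ω → Vec M), IsIterate P (F i) w →
    P[gradNoise J D k i w | F i] =ᵐ[P] 0
  uncorrelated : ∀ (i : ℕ) (k l : Fin N), k ≠ l → ∀ w : Ω → Vec M, IsIterate P (F i) w →
    ∀ m n : Fin M,
      P[fun ω => gradNoise J D k i w ω m * gradNoise J D l i w ω n | F i] =ᵐ[P] 0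
  fourth_moment : ∀ (i : ℕ) (k : Fin N) (w : Ω → Vec M), IsIterate P (F i) w →
    P[fun ω => ‖gradNoise J D k i w ω‖ ^ 4 | F i] ≤ᵐ[P]
      fun ω => β k ^ 4 * ‖w ω‖ ^ 4 + σ k ^ 4

end Algorithm

end CoordDiffusion

end

/-!
The argument takes place in the normed space `L⁴(Ω; ℝ^M)`, where the errors `w_{k,i} - w^o` of all
agents form a vector `x_i` that obeys `x_{i+1} = A₂ᵀ (A₁ᵀ x_i - μ g_i)`, with `g_i` the masked
approximate gradients. Let `p > 0` be the Perron vector of `A₁ A₂` (`exists_perron_vector`) and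
`q = A₂ p`. The error splits into its `p`-weighted average and the deviation from that average.

*Deviation.* A power of the primitive matrix `A₁ A₂` has positive entries, so it strictly contracts
the deviations (`norm_mix_le_of_entries_ge`); an adapted measure `disagreement` is then contracted
by a single step (`exists_disagreement_contraction`). The gradients are an input whose size is of
the order of the weighted step size `s = ∑ q_l μ_l`, and the triangle inequality is all that is
needed here.

*Average.* The average moves only by `∑ q_l μ_l g_l`. The conditional mean of `g_l` is
`(1 - r_l) ∇J_l`, and strong convexity makes the mean step a contraction with rate `1 - κ s`, up to
the deviation (`norm_centroid_step_le`). The remainder is orthogonal to everything determined by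
the past (`integral_norm_sq_mul_inner_mask_sub`), because the mask is independent of the past and of
the approximate gradient, whose noise has zero conditional mean. Hence it enters the *square* of the
`L⁴` norm additively, `‖a - n‖² ≤ ‖a‖² + 4 ‖n‖²` (`lpNorm_four_sub_sq_le`), and contributes only
order `s²` (`lpNorm_centroid_step_sq_le`).

For small `s` the two recursions combine into `V_{i+1} ≤ (1 - κ s / 2) V_i + O(s²)` for the sum `V`
of the squared sizes of the two components (`energy_step`), so `V` is eventually `O(s)`. Since `V`
is comparable to the square of an `L⁴` norm, this bounds the second moments by `O(s)` and the fourth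
moments by `O(s²)`, and `s ≤ μ_max`.
-/

namespace CoordDiffusion

/-! ### Averaging with left-stochastic matrices -/

section Averaging

variable {ι : Type*} [Fintype ι]

/-- Every column of the nonnegative matrix `A` adds up to one. -/
structure IsLeftStochastic (A : Matrix ι ι ℝ) : Prop where
  nonneg : ∀ l k, 0 ≤ A l k
  col_sum : ∀ k, ∑ l, A l k = 1

namespace IsLeftStochastic

variable {A B : Matrix ι ι ℝ}

lemma mul (hA : IsLeftStochastic A) (hB : IsLeftStochastic B) : IsLeftStochastic (A * B) where
  nonneg l k := by
    rw [Matrix.mul_apply]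
    exact Finset.sum_nonneg fun j _ => mul_nonneg (hA.nonneg _ _) (hB.nonneg _ _)
  col_sum k := by
    simp_rw [Matrix.mul_apply]
    rw [Finset.sum_comm]
    simp_rw [← Finset.sum_mul, hA.col_sum, one_mul, hB.col_sum]

lemma one [DecidableEq ι] : IsLeftStochastic (1 : Matrix ι ι ℝ) where
  nonneg l k := by
    rw [Matrix.one_apply]
    split_ifs <;> norm_num
  col_sum k := by simp [Matrix.one_apply]

lemma pow [DecidableEq ι] (hA : IsLeftStochastic A) (n : ℕ) : IsLeftStochastic (A ^ n) := by
  induction n with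
  | zero => simpa using one
  | succ n ih => rw [pow_succ]; exact ih.mul hA

/-- A left-stochastic matrix preserves the sum of the coordinates. -/
lemma sum_mulVec (hA : IsLeftStochastic A) (v : ι → ℝ) : ∑ k, A.mulVec v k = ∑ k, v k := by
  simp only [Matrix.mulVec, dotProduct]
  rw [Finset.sum_comm]
  simp_rw [← Finset.sum_mul, hA.col_sum, one_mul]

end IsLeftStochastic

/-- The Perron vector of a primitive left-stochastic matrix: a fixed vector exists because the row
of ones is fixed from the left, and its absolute value is fixed and positive. -/
lemma exists_perron_vector [DecidableEq ι] [Nonempty ι] {A : Matrix ι ι ℝ}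
    (hA : IsLeftStochastic A) (hprim : A.IsPrimitive) :
    ∃ p : ι → ℝ, (∀ k, 0 < p k) ∧ ∑ k, p k = 1 ∧ A.mulVec p = p := by
  obtain ⟨-, n, -, hpos⟩ := hprim
  have hdet : (A - 1).det = 0 := by
    rw [← Matrix.exists_vecMul_eq_zero_iff]
    refine ⟨fun _ => 1, fun h => one_ne_zero (congrFun h (Classical.arbitrary ι)), ?_⟩
    ext k
    simp [Matrix.vecMul, dotProduct, Matrix.one_apply, hA.col_sum]
  obtain ⟨v, hv0, hv⟩ := Matrix.exists_mulVec_eq_zero_iff.mpr hdet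
  have hv : A.mulVec v = v := by
    rwa [Matrix.sub_mulVec, Matrix.one_mulVec, sub_eq_zero] at hv
  -- The absolute value of a fixed vector is again fixed, since `|v| ≤ A |v|` and both have
  -- the same coordinate sum.
  set u : ι → ℝ := fun k => |v k| with hu
  have hle : ∀ k, u k ≤ A.mulVec u k := fun k => by
    have h1 : v k = ∑ l, A k l * v l := by
      conv_lhs => rw [← hv]
      rfl
    calc u k = |∑ l, A k l * v l| := by simp only [hu]; rw [h1]
      _ ≤ ∑ l, |A k l * v l| := Finset.abs_sum_le_sum_abs _ _
      _ = A.mulVec u k :=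
        Finset.sum_congr rfl fun l _ => by rw [abs_mul, abs_of_nonneg (hA.nonneg _ _)]
  have hfix : A.mulVec u = u := by
    have := (Finset.sum_eq_sum_iff_of_le (s := Finset.univ) fun k _ => hle k).mp
      (hA.sum_mulVec u).symm
    ext k
    exact (this k (Finset.mem_univ k)).symm
  have hfixn : ∀ m : ℕ, (A ^ m).mulVec u = u := fun m => by
    induction m with
    | zero => simp
    | succ m ih => rw [pow_succ, ← Matrix.mulVec_mulVec, hfix, ih]
  obtain ⟨j, hj⟩ : ∃ j, v j ≠ 0 := by
    by_contra! h
    exact hv0 (funext h)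
  have hupos : ∀ k, 0 < u k := fun k => by
    rw [← hfixn n]
    exact Finset.sum_pos' (fun l _ => mul_nonneg (hpos k l).le (abs_nonneg _))
      ⟨j, Finset.mem_univ j, mul_pos (hpos k j) (abs_pos.mpr hj)⟩
  have hS : 0 < ∑ k, u k := Finset.sum_pos (fun k _ => hupos k) Finset.univ_nonempty
  refine ⟨(∑ k, u k)⁻¹ • u, fun k => mul_pos (inv_pos.mpr hS) (hupos k), ?_, ?_⟩
  · simp only [Pi.smul_apply, smul_eq_mul, ← Finset.mul_sum]
    exact inv_mul_cancel₀ hS.ne'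
  · rw [Matrix.mulVec_smul, hfix]

variable {E : Type*} [NormedAddCommGroup E] [NormedSpace ℝ E]

/-- The combination step `x ↦ (∑_l a_{lk} x_l)_k` on families of vectors. -/
def mix (A : Matrix ι ι ℝ) : (ι → E) →ₗ[ℝ] (ι → E) where
  toFun x k := ∑ l, A l k • x l
  map_add' x y := by ext k; simp [smul_add, Finset.sum_add_distrib]
  map_smul' c x := by ext k; simp [Finset.smul_sum, smul_comm c]

lemma mix_apply (A : Matrix ι ι ℝ) (x : ι → E) (k : ι) : mix A x k = ∑ l, A l k • x l := rfl

lemma mix_one [DecidableEq ι] (x : ι → E) : mix (1 : Matrix ι ι ℝ) x = x := by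
  ext k; simp [mix_apply, Matrix.one_apply, ite_smul]

lemma mix_mul (A B : Matrix ι ι ℝ) (x : ι → E) : mix (A * B) x = mix B (mix A x) := by
  ext k
  simp only [mix_apply, Matrix.mul_apply, Finset.sum_smul, Finset.smul_sum, smul_smul]
  rw [Finset.sum_comm]
  simp_rw [mul_comm]

lemma norm_mix_le {A : Matrix ι ι ℝ} (hA : IsLeftStochastic A) (x : ι → E) :
    ‖mix A x‖ ≤ ‖x‖ := by
  refine (pi_norm_le_iff_of_nonneg (norm_nonneg x)).mpr fun k => ?_
  calc ‖mix A x k‖ ≤ ∑ l, ‖A l k • x l‖ := norm_sum_le _ _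
    _ ≤ ∑ l, A l k * ‖x‖ := Finset.sum_le_sum fun l _ => by
        rw [norm_smul, Real.norm_of_nonneg (hA.nonneg l k)]
        exact mul_le_mul_of_nonneg_left (norm_le_pi_norm x l) (hA.nonneg l k)
    _ = ‖x‖ := by rw [← Finset.sum_mul, hA.col_sum, one_mul]

/-- Averaging fixes the families that are constant over the agents. -/
lemma mix_const {A : Matrix ι ι ℝ} (hA : IsLeftStochastic A) (c : E) :
    mix A (fun _ => c) = fun _ => c := by
  ext k; rw [mix_apply, ← Finset.sum_smul, hA.col_sum, one_smul]

/-- The average `∑_k p_k x_k` with weights `p`. -/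
def centroid (p : ι → ℝ) : (ι → E) →ₗ[ℝ] E where
  toFun x := ∑ k, p k • x k
  map_add' x y := by simp [smul_add, Finset.sum_add_distrib]
  map_smul' c x := by simp [Finset.smul_sum, smul_comm c]

lemma centroid_apply (p : ι → ℝ) (x : ι → E) : centroid p x = ∑ k, p k • x k := rfl

lemma centroid_mix (A : Matrix ι ι ℝ) (p : ι → ℝ) (x : ι → E) :
    centroid p (mix A x) = centroid (A.mulVec p) x := by
  simp only [centroid_apply, mix_apply, Matrix.mulVec, dotProduct, Finset.smul_sum,
    Finset.sum_smul, smul_smul]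
  rw [Finset.sum_comm]
  simp_rw [mul_comm]

lemma centroid_const {p : ι → ℝ} (hp : ∑ k, p k = 1) (c : E) :
    centroid p (fun _ => c) = c := by
  rw [centroid_apply, ← Finset.sum_smul, hp, one_smul]

lemma norm_centroid_le {p : ι → ℝ} (hp0 : ∀ k, 0 ≤ p k) (hp : ∑ k, p k = 1) (x : ι → E) :
    ‖centroid p x‖ ≤ ‖x‖ := by
  calc ‖centroid p x‖ ≤ ∑ k, ‖p k • x k‖ := norm_sum_le _ _
    _ ≤ ∑ k, p k * ‖x‖ := Finset.sum_le_sum fun k _ => by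
        rw [norm_smul, Real.norm_of_nonneg (hp0 k)]
        exact mul_le_mul_of_nonneg_left (norm_le_pi_norm x k) (hp0 k)
    _ = ‖x‖ := by rw [← Finset.sum_mul, hp, one_mul]

/-- The disagreement of a family of vectors: its deviation from the weighted average. -/
def deviation (p : ι → ℝ) : (ι → E) →ₗ[ℝ] (ι → E) :=
  LinearMap.id - LinearMap.pi fun _ => centroid p

lemma deviation_apply (p : ι → ℝ) (x : ι → E) :
    deviation p x = x - fun _ => centroid p x := rfl

lemma norm_deviation_le {p : ι → ℝ} (hp0 : ∀ k, 0 ≤ p k) (hp : ∑ k, p k = 1) (x : ι → E) :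
    ‖deviation p x‖ ≤ 2 * ‖x‖ := by
  have h : ‖(fun _ : ι => centroid p x)‖ ≤ ‖x‖ :=
    (pi_norm_le_iff_of_nonneg (norm_nonneg x)).mpr fun _ => norm_centroid_le hp0 hp x
  rw [deviation_apply]
  linarith [norm_sub_le x (fun _ => centroid p x)]

lemma deviation_mix {A : Matrix ι ι ℝ} (hA : IsLeftStochastic A) {p : ι → ℝ}
    (hpA : A.mulVec p = p) (x : ι → E) : deviation p (mix A x) = mix A (deviation p x) := by
  rw [deviation_apply, deviation_apply, map_sub, mix_const hA, centroid_mix, hpA]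

/-- A left-stochastic matrix with entries at least `ε` contracts the families of zero weighted
average (Doeblin's argument: subtracting `ε p` from each column leaves mass `1 - ε`). -/
lemma norm_mix_le_of_entries_ge {A : Matrix ι ι ℝ} (hA : IsLeftStochastic A) {ε : ℝ}
    (hε : 0 ≤ ε) (hε1 : ε ≤ 1) (hent : ∀ l k, ε ≤ A l k) {p : ι → ℝ} (hp0 : ∀ k, 0 ≤ p k)
    (hp : ∑ k, p k = 1) {x : ι → E} (hx : centroid p x = 0) :
    ‖mix A x‖ ≤ (1 - ε) * ‖x‖ := by
  refine (pi_norm_le_iff_of_nonneg (mul_nonneg (by linarith) (norm_nonneg x))).mpr fun k => ?_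
  have hp1 : ∀ l, p l ≤ 1 := fun l =>
    hp ▸ Finset.single_le_sum (fun i _ => hp0 i) (Finset.mem_univ l)
  have hnn : ∀ l, 0 ≤ A l k - ε * p l := fun l => by
    nlinarith [hent l k, hp1 l, hp0 l]
  have h1 : mix A x k = ∑ l, (A l k - ε * p l) • x l := by
    simp_rw [sub_smul, Finset.sum_sub_distrib, mul_smul, ← Finset.smul_sum]
    rw [← centroid_apply p, hx, smul_zero, sub_zero, mix_apply]
  calc ‖mix A x k‖ ≤ ∑ l, ‖(A l k - ε * p l) • x l‖ := h1 ▸ norm_sum_le _ _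
    _ ≤ ∑ l, (A l k - ε * p l) * ‖x‖ := Finset.sum_le_sum fun l _ => by
        rw [norm_smul, Real.norm_of_nonneg (hnn l)]
        exact mul_le_mul_of_nonneg_left (norm_le_pi_norm x l) (hnn l)
    _ = (1 - ε) * ‖x‖ := by
        rw [← Finset.sum_mul, Finset.sum_sub_distrib, hA.col_sum, ← Finset.mul_sum, hp, mul_one]

/-- A measure of disagreement adapted to the matrix `A`, equivalent to the norm of the deviation.
The geometric weights are chosen so that one combination step contracts it by the factor `θ`
as soon as `n + 1` steps contract the deviation by `θ ^ (n + 1)`. -/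
def disagreement [DecidableEq ι] (A : Matrix ι ι ℝ) (p : ι → ℝ) (n : ℕ) (θ : ℝ) (x : ι → E) : ℝ :=
  ∑ j ∈ Finset.range (n + 1), θ ^ (n - j) * ‖mix (A ^ j) (deviation p x)‖

section Disagreement

variable [DecidableEq ι] {A : Matrix ι ι ℝ} {p : ι → ℝ} {n : ℕ} {θ : ℝ}

lemma disagreement_nonneg (hθ : 0 ≤ θ) (x : ι → E) : 0 ≤ disagreement A p n θ x :=
  Finset.sum_nonneg fun _ _ => mul_nonneg (pow_nonneg hθ _) (norm_nonneg _)

lemma disagreement_sub_le (hθ : 0 ≤ θ) (x y : ι → E) :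
    disagreement A p n θ (x - y) ≤ disagreement A p n θ x + disagreement A p n θ y := by
  simp only [disagreement, ← Finset.sum_add_distrib, ← mul_add]
  refine Finset.sum_le_sum fun j _ => mul_le_mul_of_nonneg_left ?_ (pow_nonneg hθ _)
  rw [map_sub, map_sub]
  exact norm_sub_le _ _

lemma disagreement_le (hA : IsLeftStochastic A) (hp0 : ∀ k, 0 ≤ p k) (hp : ∑ k, p k = 1)
    (hθ : 0 ≤ θ) (hθ1 : θ ≤ 1) (x : ι → E) :
    disagreement A p n θ x ≤ 2 * (n + 1) * ‖x‖ := by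
  calc disagreement A p n θ x ≤ ∑ j ∈ Finset.range (n + 1), 2 * ‖x‖ :=
        Finset.sum_le_sum fun j _ => by
          calc θ ^ (n - j) * ‖mix (A ^ j) (deviation p x)‖
              ≤ 1 * ‖mix (A ^ j) (deviation p x)‖ :=
                mul_le_mul_of_nonneg_right (pow_le_one₀ hθ hθ1) (norm_nonneg _)
            _ ≤ 2 * ‖x‖ := by
                rw [one_mul]
                exact (norm_mix_le (hA.pow j) _).trans (norm_deviation_le hp0 hp x)
    _ = 2 * (n + 1) * ‖x‖ := by
        rw [Finset.sum_const, Finset.card_range, nsmul_eq_mul]; push_cast; ring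

lemma norm_deviation_le_disagreement (hθ : 0 ≤ θ) (x : ι → E) :
    θ ^ n * ‖deviation p x‖ ≤ disagreement A p n θ x := by
  have := Finset.single_le_sum (s := Finset.range (n + 1))
    (f := fun j => θ ^ (n - j) * ‖mix (A ^ j) (deviation p x)‖)
    (fun _ _ => mul_nonneg (pow_nonneg hθ _) (norm_nonneg _)) (Finset.mem_range.mpr n.succ_pos)
  simpa only [disagreement, Nat.sub_zero, pow_zero, mix_one] using this

lemma disagreement_mix_le (hA : IsLeftStochastic A) (hpA : A.mulVec p = p)
    (hp0 : ∀ k, 0 ≤ p k) (hp : ∑ k, p k = 1) {ε : ℝ} (hε : 0 ≤ ε) (hε1 : ε ≤ 1)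
    (hent : ∀ l k, ε ≤ (A ^ (n + 1)) l k) (hθε : 1 - ε ≤ θ ^ (n + 1)) (x : ι → E) :
    disagreement A p n θ (mix A x) ≤ θ * disagreement A p n θ x := by
  have hshift : ∀ j, mix (A ^ j) (deviation p (mix A x)) = mix (A ^ (j + 1)) (deviation p x) :=
    fun j => by rw [deviation_mix hA hpA, pow_succ', mix_mul]
  have hzero : centroid p (deviation p x) = 0 := by
    rw [deviation_apply, map_sub, centroid_const hp, sub_self]
  have hlast : ‖mix (A ^ (n + 1)) (deviation p x)‖ ≤ θ ^ (n + 1) * ‖deviation p x‖ :=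
    (norm_mix_le_of_entries_ge (hA.pow _) hε hε1 hent hp0 hp hzero).trans
      (mul_le_mul_of_nonneg_right hθε (norm_nonneg _))
  unfold disagreement
  simp_rw [hshift]
  rw [Finset.sum_range_succ, Finset.sum_range_succ' _ n, mul_add, Finset.mul_sum]
  refine add_le_add (Finset.sum_le_sum fun j hj => le_of_eq ?_) ?_
  · have : n - j = (n - (j + 1)) + 1 := by have := Finset.mem_range.mp hj; omega
    rw [this, pow_succ]; ring
  · rw [Nat.sub_self, pow_zero, one_mul, Nat.sub_zero, pow_zero, mix_one, ← mul_assoc, ← pow_succ']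
    exact hlast

end Disagreement

/-- For a primitive left-stochastic matrix the parameters of `disagreement` can be chosen so that
one combination step is a strict contraction. -/
lemma exists_disagreement_contraction [DecidableEq ι] [Nonempty ι] {A : Matrix ι ι ℝ}
    (hA : IsLeftStochastic A) (hprim : A.IsPrimitive) {p : ι → ℝ} (hp0 : ∀ k, 0 ≤ p k)
    (hp : ∑ k, p k = 1) (hpA : A.mulVec p = p) :
    ∃ (n : ℕ) (θ : ℝ), 0 < θ ∧ θ < 1 ∧ ∀ {E : Type*} [NormedAddCommGroup E] [NormedSpace ℝ E]
      (x : ι → E), disagreement A p n θ (mix A x) ≤ θ * disagreement A p n θ x := by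
  obtain ⟨-, m, hm, hpos⟩ := hprim
  obtain ⟨n, rfl⟩ : ∃ n, m = n + 1 := ⟨m - 1, by omega⟩
  obtain ⟨⟨l₀, k₀⟩, -, hmin⟩ := Finset.exists_min_image (Finset.univ : Finset (ι × ι))
    (fun a => (A ^ (n + 1)) a.1 a.2) Finset.univ_nonempty
  set ε : ℝ := min ((A ^ (n + 1)) l₀ k₀) (1 / 2) with hεdef
  have hε : 0 < ε := lt_min (hpos _ _) (by norm_num)
  have hε1 : ε ≤ 1 / 2 := min_le_right _ _
  have hn : (0 : ℝ) < n + 1 := by positivity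
  have hn1 : ε / (n + 1) ≤ ε := div_le_self hε.le (by linarith [(Nat.cast_nonneg n : (0 : ℝ) ≤ n)])
  have hn0 : 0 < ε / (n + 1) := div_pos hε hn
  refine ⟨n, 1 - ε / (n + 1), by linarith, by linarith, fun x =>
    disagreement_mix_le hA hpA hp0 hp hε.le (by linarith)
      (fun l k => (min_le_left _ _).trans (hmin (l, k) (Finset.mem_univ _))) ?_ x⟩
  have hb := one_add_mul_le_pow (a := -(ε / (n + 1))) (by linarith) (n + 1)
  have : (1 : ℝ) + ((n + 1 : ℕ) : ℝ) * -(ε / (n + 1)) = 1 - ε := by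
    push_cast; field_simp; ring
  rw [this] at hb
  rwa [sub_eq_add_neg 1 (ε / _)]

end Averaging

/-! ### The coupled error recursion -/

/-- Convexity of the square: `(c x + (1 - c) y)² ≤ c x² + (1 - c) y²`, with `z = (1 - c) y`. -/
lemma sq_convex_add_le {c x z : ℝ} (hc : 0 ≤ c) (hc1 : c < 1) :
    (c * x + z) ^ 2 ≤ c * x ^ 2 + z ^ 2 / (1 - c) := by
  have h : 0 < 1 - c := by linarith
  have key : c * x ^ 2 + z ^ 2 / (1 - c) - (c * x + z) ^ 2
      = c / (1 - c) * ((1 - c) * x - z) ^ 2 := by field_simp; ring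
  have : 0 ≤ c / (1 - c) * ((1 - c) * x - z) ^ 2 :=
    mul_nonneg (div_nonneg hc h.le) (sq_nonneg _)
  linarith

/-- A sequence bounded by an affine contraction with rate `1 - a` and input `d` eventually drops below
every level above the fixed point `d / a`. -/
lemma eventually_le_of_affine_contraction {V : ℕ → ℝ} {a d e : ℝ} (ha : 0 < a) (ha1 : a ≤ 1)
    (he : 0 < e) (hV : ∀ i, V (i + 1) ≤ (1 - a) * V i + d) :
    ∀ᶠ i in atTop, V i ≤ d / a + e := by
  have hbound : ∀ i, V i - d / a ≤ (1 - a) ^ i * |V 0 - d / a| := fun i => by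
    induction i with
    | zero => simpa using le_abs_self (V 0 - d / a)
    | succ i ih =>
      calc V (i + 1) - d / a ≤ (1 - a) * (V i - d / a) := by
            have : d = a * (d / a) := by field_simp
            nlinarith [hV i]
        _ ≤ (1 - a) * ((1 - a) ^ i * |V 0 - d / a|) :=
            mul_le_mul_of_nonneg_left ih (by linarith)
        _ = _ := by ring
  have hlim : Tendsto (fun i : ℕ => (1 - a) ^ i * |V 0 - d / a|) atTop (nhds 0) := by
    simpa using (tendsto_pow_atTop_nhds_zero_of_lt_one (by linarith : 0 ≤ 1 - a)
      (by linarith)).mul_const |V 0 - d / a|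
  filter_upwards [hlim.eventually (gt_mem_nhds he)] with i hi
  linarith [hbound i]

/-- One step of the coupled recursion for the size `α` of the average error and the disagreement
`η`: for small `s` the energy `α² + η²` contracts at a rate proportional to `s`, up to an input
of order `s²`. -/
lemma energy_step {κ θ D G K s α η α' η' : ℝ} (hκ : 0 < κ) (hθ : 0 ≤ θ) (hθ1 : θ < 1)
    (hG : 0 ≤ G) (hs : 0 < s) (hs1 : s * κ ≤ (1 - θ) / 2)
    (hs2 : s * (D ^ 2 / κ) ≤ (1 - θ) / 2)
    (hs3 : s * (3 * (G + K ^ 2 / (1 - θ))) ≤ κ / 2)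
    (hη' : 0 ≤ η')
    (h1 : α' ^ 2 ≤ ((1 - κ * s) * α + D * s * η) ^ 2 + G * s ^ 2 * (α + η + 1) ^ 2)
    (h2 : η' ≤ θ * η + K * s * (α + η + 1)) :
    α' ^ 2 + η' ^ 2 ≤ (1 - κ * s / 2) * (α ^ 2 + η ^ 2)
      + 3 * (G + K ^ 2 / (1 - θ)) * s ^ 2 := by
  have hκs : 0 < κ * s := mul_pos hκ hs
  have e1 : ((1 - κ * s) * α + D * s * η) ^ 2
      ≤ (1 - κ * s) * α ^ 2 + s * (D ^ 2 / κ) * η ^ 2 := by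
    refine (sq_convex_add_le (by linarith) (by linarith)).trans (le_of_eq ?_)
    field_simp; ring
  have e2 : η' ^ 2 ≤ θ * η ^ 2 + K ^ 2 / (1 - θ) * s ^ 2 * (α + η + 1) ^ 2 := by
    refine (pow_le_pow_left₀ hη' h2 2).trans ((sq_convex_add_le hθ hθ1).trans (le_of_eq ?_))
    field_simp
  have e3 : (α + η + 1) ^ 2 ≤ 3 * (α ^ 2 + η ^ 2 + 1) := by
    nlinarith [sq_nonneg (α - η), sq_nonneg (α - 1), sq_nonneg (η - 1)]
  have hH : 0 ≤ G + K ^ 2 / (1 - θ) := add_nonneg hG (div_nonneg (sq_nonneg _) (by linarith))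
  set H := G + K ^ 2 / (1 - θ) with hHdef
  have e4 : H * s ^ 2 * (α + η + 1) ^ 2 ≤ H * s ^ 2 * (3 * (α ^ 2 + η ^ 2 + 1)) :=
    mul_le_mul_of_nonneg_left e3 (by positivity)
  have e5 : s * (3 * H) * s * (α ^ 2 + η ^ 2) ≤ κ / 2 * s * (α ^ 2 + η ^ 2) := by
    gcongr
  have e6 : (θ + s * (D ^ 2 / κ)) * η ^ 2 ≤ (1 - κ * s) * η ^ 2 :=
    mul_le_mul_of_nonneg_right (by linarith) (sq_nonneg _)
  have e7 : G * s ^ 2 * (α + η + 1) ^ 2 + K ^ 2 / (1 - θ) * s ^ 2 * (α + η + 1) ^ 2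
      = H * s ^ 2 * (α + η + 1) ^ 2 := by rw [hHdef]; ring
  linarith

/-- For small `s` the solutions of the coupled recursion are eventually of order `√s`, with
constants that do not depend on `s`. -/
lemma exists_eventually_sq_le {κ θ D G K b : ℝ} (hκ : 0 < κ) (hθ : 0 ≤ θ) (hθ1 : θ < 1)
    (hG : 0 ≤ G) :
    ∃ C s₀ : ℝ, 0 < C ∧ 0 < s₀ ∧ ∀ s : ℝ, 0 < s → s < s₀ → ∀ α η : ℕ → ℝ,
      (∀ i, 0 ≤ η i) →
      (∀ i, α (i + 1) ^ 2
        ≤ ((1 - κ * s) * α i + D * s * η i) ^ 2 + G * s ^ 2 * (α i + η i + 1) ^ 2) →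
      (∀ i, η (i + 1) ≤ θ * η i + K * s * (α i + η i + 1)) →
      ∀ᶠ i in atTop, (α i + b * η i) ^ 2 ≤ C * s := by
  set H := 3 * (G + K ^ 2 / (1 - θ)) with hH
  have hH0 : 0 ≤ H :=
    mul_nonneg (by norm_num) (add_nonneg hG (div_nonneg (sq_nonneg _) (by linarith)))
  have hθ2 : 0 < (1 - θ) / 2 := by linarith
  have hD : 0 ≤ D ^ 2 / κ := by positivity
  refine ⟨(1 + b ^ 2) * (2 * H / κ + 1),
    min ((1 - θ) / 2 / κ) (min ((1 - θ) / 2 / (D ^ 2 / κ + 1)) (κ / 2 / (H + 1))),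
    by positivity, lt_min (by positivity) (lt_min (by positivity) (by positivity)), ?_⟩
  intro s hs hs0 α η hη h1 h2
  obtain ⟨hs1, hs2, hs3⟩ : s < (1 - θ) / 2 / κ ∧ s < (1 - θ) / 2 / (D ^ 2 / κ + 1) ∧
      s < κ / 2 / (H + 1) := by simpa [lt_min_iff] using hs0
  rw [lt_div_iff₀ (by positivity)] at hs1 hs2 hs3
  have hstep : ∀ i, α (i + 1) ^ 2 + η (i + 1) ^ 2
      ≤ (1 - κ * s / 2) * (α i ^ 2 + η i ^ 2) + H * s ^ 2 := fun i =>
    energy_step hκ hθ hθ1 hG hs hs1.le (by nlinarith) (by rw [← hH]; nlinarith) (hη _)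
      (h1 i) (h2 i)
  filter_upwards [eventually_le_of_affine_contraction (V := fun i => α i ^ 2 + η i ^ 2)
    (by positivity) (by nlinarith) hs hstep] with i hi
  have hfix : H * s ^ 2 / (κ * s / 2) + s = (2 * H / κ + 1) * s := by field_simp
  rw [hfix] at hi
  calc (α i + b * η i) ^ 2 ≤ (1 + b ^ 2) * (α i ^ 2 + η i ^ 2) := by
        nlinarith [sq_nonneg (b * α i - η i)]
    _ ≤ (1 + b ^ 2) * ((2 * H / κ + 1) * s) := mul_le_mul_of_nonneg_left hi (by positivity)
    _ = _ := by ring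

/-! ### Gradients of strongly convex costs -/

section Gradient

open scoped RealInnerProductSpace

variable {M : ℕ} {ν δ : ℝ} {J : Vec M → ℝ}

namespace HasHessianBounds

lemma inner_fderiv_ge (hJ : HasHessianBounds ν δ J) (w v : Vec M) :
    ν * ‖v‖ ^ 2 ≤ ⟪fderiv ℝ (gradient J) w v, v⟫ := by
  have h := (ContinuousLinearMap.le_def _ _).mp (hJ.lower w)
  have := h.inner_nonneg_left v
  simp only [sub_apply, smul_apply,
    ContinuousLinearMap.id_apply, inner_sub_left, real_inner_smul_left,
    real_inner_self_eq_norm_sq] at this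
  linarith

lemma inner_fderiv_le (hJ : HasHessianBounds ν δ J) (w v : Vec M) :
    ⟪fderiv ℝ (gradient J) w v, v⟫ ≤ δ * ‖v‖ ^ 2 := by
  have h := (ContinuousLinearMap.le_def _ _).mp (hJ.upper w)
  have := h.inner_nonneg_left v
  simp only [sub_apply, smul_apply,
    ContinuousLinearMap.id_apply, inner_sub_left, real_inner_smul_left,
    real_inner_self_eq_norm_sq] at this
  linarith

lemma inner_fderiv_symm (hJ : HasHessianBounds ν δ J) (w u v : Vec M) :
    ⟪fderiv ℝ (gradient J) w u, v⟫ = ⟪u, fderiv ℝ (gradient J) w v⟫ := by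
  have h := ((ContinuousLinearMap.le_def _ _).mp (hJ.lower w)).inner_left_eq_inner_right u v
  simp only [sub_apply, smul_apply,
    ContinuousLinearMap.id_apply, inner_sub_left, inner_sub_right, real_inner_smul_left,
    real_inner_smul_right] at h
  linarith

lemma norm_fderiv_le (hJ : HasHessianBounds ν δ J) (hν : 0 ≤ ν) (hδ : 0 ≤ δ) (w : Vec M) :
    ‖fderiv ℝ (gradient J) w‖ ≤ δ := by
  refine ContinuousLinearMap.opNorm_le_bound _ hδ fun v => ?_
  set H := fderiv ℝ (gradient J) w
  rcases eq_or_ne (H v) 0 with h0 | h0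
  · rw [h0, norm_zero]; positivity
  -- Polarization with the vectors `t v ± t⁻¹ H v`, where `t² = ‖H v‖ / ‖v‖`, written without roots.
  have hpos : 0 < ‖H v‖ := norm_pos_iff.mpr h0
  have h1 := hJ.inner_fderiv_le w (‖H v‖ • v + ‖v‖ • H v)
  have h2 := hJ.inner_fderiv_ge w (‖H v‖ • v - ‖v‖ • H v)
  have h2' : 0 ≤ ν * ‖‖H v‖ • v - ‖v‖ • H v‖ ^ 2 := by positivity
  have h3 : ‖‖H v‖ • v + ‖v‖ • H v‖ ≤ 2 * (‖v‖ * ‖H v‖) := by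
    refine (norm_add_le _ _).trans (le_of_eq ?_)
    rw [norm_smul, norm_smul, norm_norm, norm_norm]; ring
  have h4 : ‖‖H v‖ • v + ‖v‖ • H v‖ ^ 2 ≤ (2 * (‖v‖ * ‖H v‖)) ^ 2 :=
    pow_le_pow_left₀ (norm_nonneg _) h3 2
  have hsymm : ⟪H (H v), v⟫ = ⟪H v, H v⟫ := hJ.inner_fderiv_symm w (H v) v
  simp only [map_add, map_sub, map_smul, inner_add_left, inner_add_right, inner_sub_left,
    inner_sub_right, real_inner_smul_left, real_inner_smul_right] at h1 h2
  have h5 : 4 * (‖H v‖ * ‖v‖ * ‖H v‖ ^ 2) ≤ δ * (2 * (‖v‖ * ‖H v‖)) ^ 2 := by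
    have := mul_le_mul_of_nonneg_left h4 hδ
    rw [← real_inner_self_eq_norm_sq (H v)]
    have e1 : ⟪fderiv ℝ (gradient J) w (H v), v⟫ = ⟪H v, H v⟫ := hsymm
    have e2 : ⟪fderiv ℝ (gradient J) w v, H v⟫ = ⟪H v, H v⟫ := rfl
    rw [e1, e2] at h1 h2
    linarith
  rcases (norm_nonneg v).eq_or_lt with hv | hv
  · exact absurd (by rw [norm_eq_zero.mp hv.symm, map_zero]) h0
  · have : 0 < 4 * (‖H v‖ ^ 2 * ‖v‖) := by positivity
    refine le_of_mul_le_mul_left ?_ this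
    linarith

lemma norm_gradient_sub_le (hJ : HasHessianBounds ν δ J) (hν : 0 ≤ ν) (hδ : 0 ≤ δ)
    (x y : Vec M) : ‖gradient J x - gradient J y‖ ≤ δ * ‖x - y‖ :=
  convex_univ.norm_image_sub_le_of_norm_fderiv_le
    (fun w _ => hJ.differentiable_gradient w) (fun w _ => hJ.norm_fderiv_le hν hδ w)
    (Set.mem_univ y) (Set.mem_univ x)

lemma inner_gradient_sub_ge (hJ : HasHessianBounds ν δ J) (x y : Vec M) :
    ν * ‖x - y‖ ^ 2 ≤ ⟪gradient J x - gradient J y, x - y⟫ := by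
  have hd : ∀ t : ℝ, HasDerivAt (fun t : ℝ => ⟪gradient J (y + t • (x - y)), x - y⟫)
      ⟪fderiv ℝ (gradient J) (y + t • (x - y)) (x - y), x - y⟫ t := fun t => by
    have hl : HasDerivAt (fun t : ℝ => y + t • (x - y)) (x - y) t := by
      simpa using ((hasDerivAt_id t).smul_const (x - y)).const_add y
    have := ((hJ.differentiable_gradient (y + t • (x - y))).hasFDerivAt.comp_hasDerivAt t hl).inner
      ℝ (hasDerivAt_const t (x - y))
    simpa using this
  obtain ⟨t, -, ht⟩ := exists_hasDerivAt_eq_slope _ _ zero_lt_one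
    (fun t _ => (hd t).continuousAt.continuousWithinAt) (fun t _ => hd t)
  have := hJ.inner_fderiv_ge (y + t • (x - y)) (x - y)
  rw [ht] at this
  simpa [inner_sub_left] using this

lemma continuous_gradient (hJ : HasHessianBounds ν δ J) : Continuous (gradient J) :=
  hJ.differentiable_gradient.continuous

end HasHessianBounds

lemma gradient_eq_zero_of_minimizer {wo : Vec M} (h : ∀ w, J wo ≤ J w) : gradient J wo = 0 := by
  have : fderiv ℝ J wo = 0 := IsLocalMin.fderiv_eq_zero (Filter.Eventually.of_forall h)
  simp [gradient, this]

end Gradient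

section Descent

open scoped RealInnerProductSpace

variable {F : Type*} [NormedAddCommGroup F] [InnerProductSpace ℝ F]

/-- A small step along a strongly monotone and Lipschitz direction contracts. -/
lemma norm_sub_le_of_monotone {c g : F} {s κ L : ℝ} (hs : 0 ≤ s) (hκ : κ * s ≤ 1)
    (hL : L ^ 2 * s ≤ 2 * κ) (hmono : 2 * κ * s * ‖c‖ ^ 2 ≤ ⟪g, c⟫) (hlip : ‖g‖ ≤ L * s * ‖c‖) :
    ‖c - g‖ ≤ (1 - κ * s) * ‖c‖ := by
  refine abs_le_of_sq_le_sq' ?_ (mul_nonneg (by linarith) (norm_nonneg c)) |>.2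
  have h1 : ‖g‖ ^ 2 ≤ (L * s * ‖c‖) ^ 2 := pow_le_pow_left₀ (norm_nonneg g) hlip 2
  have h2 : L ^ 2 * s * (s * ‖c‖ ^ 2) ≤ 2 * κ * (s * ‖c‖ ^ 2) :=
    mul_le_mul_of_nonneg_right hL (by positivity)
  rw [norm_sub_sq_real, real_inner_comm]
  nlinarith [sq_nonneg (κ * s * ‖c‖)]

/-- The gradient step of the weighted average, evaluated at points near that average. The drift is
measured by the weighted step size `s = ∑_l u_l`. -/
lemma norm_centroid_step_le {ι : Type*} [Fintype ι] {G : ι → F → F} {t u : ι → ℝ} {ν δ ρ : ℝ}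
    (hν : 0 ≤ ν) (hu : ∀ l, 0 ≤ u l) (ht : ∀ l, ρ ≤ t l) (ht1 : ∀ l, t l ≤ 1)
    (hρ : 0 ≤ ρ)
    (hmono : ∀ l c, ν * ‖c‖ ^ 2 ≤ ⟪G l c, c⟫) (hG0 : ∀ l, G l 0 = 0)
    (hlip : ∀ l c d, ‖G l c - G l d‖ ≤ δ * ‖c - d‖)
    (hs1 : ρ * ν / 2 * ∑ l, u l ≤ 1) (hs2 : δ ^ 2 * ∑ l, u l ≤ ρ * ν) (c : F) (y : ι → F) :
    ‖c - ∑ l, (u l * t l) • G l (y l)‖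
      ≤ (1 - ρ * ν / 2 * ∑ l, u l) * ‖c‖ + ∑ l, u l * (δ * ‖y l - c‖) := by
  have hsplit : c - ∑ l, (u l * t l) • G l (y l)
      = (c - ∑ l, (u l * t l) • G l c) - ∑ l, (u l * t l) • (G l (y l) - G l c) := by
    simp_rw [smul_sub, Finset.sum_sub_distrib]; abel
  have ht0 : ∀ l, 0 ≤ t l := fun l => hρ.trans (ht l)
  have hut : ∀ l, u l * t l ≤ u l := fun l => mul_le_of_le_one_right (hu l) (ht1 l)
  rw [hsplit]
  refine (norm_sub_le _ _).trans (add_le_add (norm_sub_le_of_monotone (L := δ)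
    (Finset.sum_nonneg fun l _ => hu l) hs1 (by linarith) ?_ ?_) ?_)
  · rw [sum_inner]
    calc 2 * (ρ * ν / 2) * (∑ l, u l) * ‖c‖ ^ 2 = ∑ l, u l * (ρ * (ν * ‖c‖ ^ 2)) := by
          rw [← Finset.sum_mul]; ring
      _ ≤ ∑ l, ⟪(u l * t l) • G l c, c⟫ := Finset.sum_le_sum fun l _ => by
          rw [real_inner_smul_left, mul_assoc]
          refine mul_le_mul_of_nonneg_left ?_ (hu l)
          exact mul_le_mul (ht l) (hmono l c) (by positivity) (ht0 l)
  · calc ‖∑ l, (u l * t l) • G l c‖ ≤ ∑ l, ‖(u l * t l) • G l c‖ := norm_sum_le _ _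
      _ ≤ ∑ l, u l * (δ * ‖c‖) := Finset.sum_le_sum fun l _ => by
          rw [norm_smul, Real.norm_of_nonneg (mul_nonneg (hu l) (ht0 l))]
          have := hlip l c 0
          rw [hG0, sub_zero, sub_zero] at this
          exact mul_le_mul (hut l) this (norm_nonneg _) (hu l)
      _ = δ * (∑ l, u l) * ‖c‖ := by rw [← Finset.sum_mul]; ring
  · refine (norm_sum_le _ _).trans (Finset.sum_le_sum fun l _ => ?_)
    rw [norm_smul, Real.norm_of_nonneg (mul_nonneg (hu l) (ht0 l))]
    exact mul_le_mul (hut l) (hlip l _ _) (norm_nonneg _) (hu l)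

end Descent

/-! ### Fourth moments of martingale increments -/

section FourthMoment

open scoped RealInnerProductSpace

variable {Ω : Type*} {m0 : MeasurableSpace Ω} {P : Measure Ω}

lemma lpNorm_four_pow {E : Type*} [NormedAddCommGroup E] {f : Ω → E} (hf : MemLp f 4 P) :
    lpNorm f 4 P ^ 4 = ∫ ω, ‖f ω‖ ^ 4 ∂P := by
  rw [lpNorm_eq_integral_norm_rpow_toReal (by norm_num) (by norm_num) hf.aestronglyMeasurable]
  have h : (0 : ℝ) ≤ ∫ ω, ‖f ω‖ ^ (4 : ℝ≥0∞).toReal ∂P :=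
    integral_nonneg fun ω => by positivity
  rw [← Real.rpow_natCast _ 4, ← Real.rpow_mul h]
  norm_num

lemma integrable_norm_pow_four {E : Type*} [NormedAddCommGroup E] {f : Ω → E}
    (hf : MemLp f 4 P) : Integrable (fun ω => ‖f ω‖ ^ 4) P := by
  simpa using hf.integrable_norm_rpow (by norm_num) (by norm_num)

lemma integrable_norm_cube_mul {E : Type*} [NormedAddCommGroup E] {f g : Ω → E}
    (hf : MemLp f 4 P) (hg : MemLp g 4 P) :
    Integrable (fun ω => ‖f ω‖ ^ 3 * ‖g ω‖) P := by
  refine ((integrable_norm_pow_four hf).add (integrable_norm_pow_four hg)).mono'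
    ((hf.1.norm.pow 3).mul hg.1.norm) (Eventually.of_forall fun ω => ?_)
  rw [Real.norm_of_nonneg (by positivity), Pi.add_apply]
  have hx := norm_nonneg (f ω)
  have hy := norm_nonneg (g ω)
  generalize ‖f ω‖ = x at *
  generalize ‖g ω‖ = y at *
  rcases le_total x y with h | h
  · have := mul_le_mul_of_nonneg_right (pow_le_pow_left₀ hx h 3) hy
    nlinarith [pow_nonneg hx 4]
  · have := mul_le_mul_of_nonneg_left h (pow_nonneg hx 3)
    nlinarith [pow_nonneg hy 4]

lemma lpNorm_le_mul_of_norm_le {E F : Type*} [NormedAddCommGroup E] [NormedAddCommGroup F]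
    {f : Ω → E} {g : Ω → F} {c : ℝ} (hc : 0 ≤ c) (hg : MemLp g 4 P)
    (h : ∀ ω, ‖f ω‖ ≤ c * ‖g ω‖) : lpNorm f 4 P ≤ c * lpNorm g 4 P := by
  have h1 : lpNorm (c • fun ω => ‖g ω‖) 4 P = c * lpNorm g 4 P := by
    rw [lpNorm_const_smul, lpNorm_norm hg.1, coe_nnnorm, Real.norm_of_nonneg hc]
  rw [← h1]
  exact lpNorm_mono_real (hg.norm.const_smul c) h

variable {F : Type*} [NormedAddCommGroup F] [InnerProductSpace ℝ F]

lemma integrable_norm_sq_mul_inner {f g : Ω → F} (hf : MemLp f 4 P) (hg : MemLp g 4 P) :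
    Integrable (fun ω => ‖f ω‖ ^ 2 * ⟪f ω, g ω⟫) P := by
  refine (integrable_norm_cube_mul hf hg).mono' ((hf.1.norm.pow 2).mul (hf.1.inner hg.1))
    (Eventually.of_forall fun ω => ?_)
  rw [norm_mul, Real.norm_of_nonneg (by positivity : (0 : ℝ) ≤ ‖f ω‖ ^ 2)]
  calc ‖f ω‖ ^ 2 * ‖⟪f ω, g ω⟫‖ ≤ ‖f ω‖ ^ 2 * (‖f ω‖ * ‖g ω‖) :=
        mul_le_mul_of_nonneg_left (norm_inner_le_norm _ _) (by positivity)
    _ = _ := by ring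

/-- Hölder's inequality for the product of two squared norms. -/
lemma integral_sq_mul_sq_le {E : Type*} [NormedAddCommGroup E] {f g : Ω → E}
    (hf : MemLp f 4 P) (hg : MemLp g 4 P) :
    ∫ ω, ‖f ω‖ ^ 2 * ‖g ω‖ ^ 2 ∂P ≤ lpNorm f 4 P ^ 2 * lpNorm g 4 P ^ 2 := by
  have hL2 : ∀ {f : Ω → E}, MemLp f 4 P → MemLp (fun ω => ‖f ω‖ ^ 2) (ENNReal.ofReal 2) P := by
    intro f hf
    have h2 : ENNReal.ofReal 2 = 2 := by norm_num
    rw [h2]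
    refine (memLp_two_iff_integrable_sq (hf.1.norm.pow 2)).mpr ?_
    refine (integrable_norm_pow_four hf).congr (Eventually.of_forall fun ω => ?_)
    simp only [Pi.pow_apply]; ring
  have hroot : ∀ {f : Ω → E}, MemLp f 4 P →
      (∫ ω, (‖f ω‖ ^ 2) ^ (2 : ℝ) ∂P) ^ (1 / (2 : ℝ)) = lpNorm f 4 P ^ 2 := by
    intro f hf
    have : ∫ ω, (‖f ω‖ ^ 2) ^ (2 : ℝ) ∂P = (lpNorm f 4 P ^ 2) ^ 2 := by
      rw [← pow_mul, lpNorm_four_pow hf]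
      refine integral_congr_ae (Eventually.of_forall fun ω => ?_)
      simp only
      rw [Real.rpow_two]; ring
    rw [this, ← Real.sqrt_eq_rpow, Real.sqrt_sq (by positivity)]
  have := integral_mul_le_Lp_mul_Lq_of_nonneg (μ := P) Real.HolderConjugate.two_two
    (Eventually.of_forall fun ω => sq_nonneg ‖f ω‖)
    (Eventually.of_forall fun ω => sq_nonneg ‖g ω‖) (hL2 hf) (hL2 hg)
  rwa [hroot hf, hroot hg] at this

/-- In `L⁴` the square of the norm grows at most additively under a perturbation `n` that is
orthogonal to `‖a‖² a`, in particular under a martingale increment. The first-order term of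
`‖a - n‖⁴` vanishes, and the remaining terms complete the square `(‖a‖² + 4 ‖n‖²)²`. -/
lemma lpNorm_four_sub_sq_le {a n : Ω → F} (ha : MemLp a 4 P) (hn : MemLp n 4 P)
    (horth : ∫ ω, ‖a ω‖ ^ 2 * ⟪a ω, n ω⟫ ∂P = 0) :
    lpNorm (a - n) 4 P ^ 2 ≤ lpNorm a 4 P ^ 2 + 4 * lpNorm n 4 P ^ 2 := by
  have hpt : ∀ ω, ‖(a - n) ω‖ ^ 4 ≤ ‖a ω‖ ^ 4 - 4 * (‖a ω‖ ^ 2 * ⟪a ω, n ω⟫)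
      + 8 * (‖a ω‖ ^ 2 * ‖n ω‖ ^ 2) + 3 * ‖n ω‖ ^ 4 := fun ω => by
    have h1 : ‖(a - n) ω‖ ^ 4 = (‖a ω‖ ^ 2 - 2 * ⟪a ω, n ω⟫ + ‖n ω‖ ^ 2) ^ 2 := by
      rw [← norm_sub_sq_real, Pi.sub_apply]; ring
    have h2 := abs_real_inner_le_norm (a ω) (n ω)
    rw [h1]
    have hx := norm_nonneg (a ω)
    have hy := norm_nonneg (n ω)
    generalize ⟪a ω, n ω⟫ = t at *
    generalize ‖a ω‖ = x at *
    generalize ‖n ω‖ = y at *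
    have h3 : t ^ 2 ≤ (x * y) ^ 2 := sq_le_sq' (by linarith [(abs_le.mp h2).1]) (abs_le.mp h2).2
    have h4 : -(t * y ^ 2) ≤ (x * y) * y ^ 2 := by
      nlinarith [(abs_le.mp h2).1, sq_nonneg y]
    nlinarith [mul_nonneg (sq_nonneg y) (sq_nonneg (x - y))]
  have hsq : Integrable (fun ω => ‖a ω‖ ^ 2 * ‖n ω‖ ^ 2) P := by
    refine ((integrable_norm_pow_four ha).add (integrable_norm_pow_four hn)).mono'
      ((ha.1.norm.pow 2).mul (hn.1.norm.pow 2)) (Eventually.of_forall fun ω => ?_)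
    rw [Real.norm_of_nonneg (by positivity), Pi.add_apply]
    nlinarith [sq_nonneg (‖a ω‖ ^ 2 - ‖n ω‖ ^ 2), sq_nonneg (‖a ω‖ ^ 2 + ‖n ω‖ ^ 2)]
  have i1 := integrable_norm_pow_four ha
  have i2 := (integrable_norm_sq_mul_inner ha hn).const_mul 4
  have i3 := hsq.const_mul 8
  have i4 := (integrable_norm_pow_four hn).const_mul 3
  have i12 : Integrable (fun ω => ‖a ω‖ ^ 4 - 4 * (‖a ω‖ ^ 2 * ⟪a ω, n ω⟫)) P := i1.sub i2
  have i123 : Integrable (fun ω => ‖a ω‖ ^ 4 - 4 * (‖a ω‖ ^ 2 * ⟪a ω, n ω⟫)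
      + 8 * (‖a ω‖ ^ 2 * ‖n ω‖ ^ 2)) P := i12.add i3
  have hval : ∫ ω, (‖a ω‖ ^ 4 - 4 * (‖a ω‖ ^ 2 * ⟪a ω, n ω⟫)
      + 8 * (‖a ω‖ ^ 2 * ‖n ω‖ ^ 2) + 3 * ‖n ω‖ ^ 4) ∂P
      = lpNorm a 4 P ^ 4 + 8 * (∫ ω, ‖a ω‖ ^ 2 * ‖n ω‖ ^ 2 ∂P) + 3 * lpNorm n 4 P ^ 4 := by
    rw [integral_add i123 i4, integral_add i12 i3, integral_sub i1 i2,
      integral_const_mul, integral_const_mul, integral_const_mul, horth, lpNorm_four_pow ha,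
      lpNorm_four_pow hn]
    ring
  have h4 : lpNorm (a - n) 4 P ^ 4 ≤ lpNorm a 4 P ^ 4
      + 8 * (lpNorm a 4 P ^ 2 * lpNorm n 4 P ^ 2) + 3 * lpNorm n 4 P ^ 4 := by
    rw [lpNorm_four_pow (ha.sub hn)]
    refine (integral_mono (integrable_norm_pow_four (ha.sub hn)) (i123.add i4) hpt).trans ?_
    refine hval.le.trans ?_
    linarith [integral_sq_mul_sq_le ha hn]
  refine abs_le_of_sq_le_sq' ?_ (by positivity) |>.2
  nlinarith [sq_nonneg (lpNorm n 4 P ^ 2)]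

end FourthMoment

section MaskedNoise

open scoped RealInnerProductSpace

variable {Ω : Type*} {𝓕 m0 : MeasurableSpace Ω} {P : Measure Ω} {M : ℕ}

lemma mask_apply (r : Fin M → ℝ) (v : Vec M) (m : Fin M) : mask r v m = r m * v m := by
  simp [mask, Matrix.mulVec_diagonal]

lemma norm_mask_le {r : Fin M → ℝ} (hr : ∀ m, r m = 0 ∨ r m = 1) (v : Vec M) :
    ‖mask r v‖ ≤ ‖v‖ := by
  refine abs_le_of_sq_le_sq' ?_ (norm_nonneg _) |>.2
  rw [EuclideanSpace.norm_sq_eq, EuclideanSpace.norm_sq_eq]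
  refine Finset.sum_le_sum fun m _ => ?_
  rw [mask_apply]
  rcases hr m with h | h <;> simp [h, sq_nonneg]

lemma measurable_mask {s : Fin M → Ω → ℝ} {g : Ω → Vec M} (hs : ∀ m, Measurable (s m))
    (hg : Measurable g) : Measurable (fun ω => mask (fun m => s m ω) (g ω)) := by
  refine (WithLp.measurable_toLp 2 _).comp (measurable_pi_lambda _ fun m => ?_)
  simp only [Matrix.mulVec_diagonal]
  have := hs m
  fun_prop

lemma memLp_mask {s : Fin M → Ω → ℝ} {g : Ω → Vec M} (hs : ∀ m, Measurable (s m))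
    (hs01 : ∀ m ω, s m ω = 0 ∨ s m ω = 1) (hg : Measurable g) (hg4 : MemLp g 4 P) :
    MemLp (fun ω => mask (fun m => s m ω) (g ω)) 4 P :=
  hg4.mono (measurable_mask hs hg).aestronglyMeasurable
    (Eventually.of_forall fun ω => norm_mask_le (fun m => hs01 m ω) _)

variable [IsProbabilityMeasure P]

lemma integral_indicator_variable {ξ : Ω → ℝ} (hξ : Measurable ξ) (h01 : ∀ ω, ξ ω = 0 ∨ ξ ω = 1)
    {ρ : ℝ} (hρ : 0 ≤ ρ) (hP : P {ω | ξ ω = 0} = ENNReal.ofReal ρ) : ∫ ω, ξ ω ∂P = 1 - ρ := by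
  have hmeas : MeasurableSet {ω | ξ ω = 0} := hξ (measurableSet_singleton 0)
  have hind : ξ = fun ω => 1 - Set.indicator {ω | ξ ω = 0} (fun _ => (1 : ℝ)) ω := by
    funext ω
    rcases h01 ω with h | h <;> simp [Set.indicator, h]
  rw [hind, integral_sub (integrable_const _) ((integrable_const _).indicator hmeas),
    integral_indicator hmeas]
  simp [Measure.real, hP, hρ]

/-- The perturbation of the masked gradient step, `Γ ĝ - (1 - ρ) h`, is orthogonal to every vector
determined by the past. The mask is independent of the past and of `ĝ`, which reduces the claim to
the conditional unbiasedness of `ĝ`. -/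
lemma integral_norm_sq_mul_inner_mask_sub (h𝓕 : 𝓕 ≤ m0)
    {a g h : Ω → Vec M} {r : Fin M → Ω → ℝ} {ρ : ℝ}
    (ha : Measurable[𝓕] a) (ha4 : MemLp a 4 P) (hg : Measurable g) (hg4 : MemLp g 4 P)
    (hh4 : MemLp h 4 P) (hcond : P[g - h | 𝓕] =ᵐ[P] 0) (hr : ∀ m, Measurable (r m))
    (hr01 : ∀ m ω, r m ω = 0 ∨ r m ω = 1) (hρ : 0 ≤ ρ)
    (hrP : ∀ m, P {ω | r m ω = 0} = ENNReal.ofReal ρ)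
    (hindep : ∀ m, Indep (MeasurableSpace.comap (r m) inferInstance)
      (𝓕 ⊔ MeasurableSpace.comap g inferInstance) P) :
    ∫ ω, ‖a ω‖ ^ 2 * ⟪a ω, mask (fun m => r m ω) (g ω) - (1 - ρ) • h ω⟫ ∂P = 0 := by
  have hcoord : ∀ v w : Vec M, ⟪v, w⟫ = ∑ m, v m * w m := fun v w => by
    simp [PiLp.inner_apply, mul_comm]
  have hmask : ∫ ω, ‖a ω‖ ^ 2 * ⟪a ω, mask (fun m => r m ω) (g ω)⟫ ∂P
      = (1 - ρ) * ∫ ω, ‖a ω‖ ^ 2 * ⟪a ω, g ω⟫ ∂P := by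
    have hint : ∀ m, Integrable (fun ω => ‖a ω‖ ^ 2 * (a ω m * g ω m)) P := fun m => by
      have hmeas : Measurable (fun ω => ‖a ω‖ ^ 2 * (a ω m * g ω m)) := by
        have := ha.mono h𝓕 le_rfl
        fun_prop
      refine (integrable_norm_cube_mul ha4 hg4).mono' hmeas.aestronglyMeasurable
        (Eventually.of_forall fun ω => ?_)
      rw [norm_mul, norm_mul, Real.norm_of_nonneg (by positivity : (0 : ℝ) ≤ ‖a ω‖ ^ 2)]
      calc ‖a ω‖ ^ 2 * (‖a ω m‖ * ‖g ω m‖) ≤ ‖a ω‖ ^ 2 * (‖a ω‖ * ‖g ω‖) := by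
            gcongr
            · exact PiLp.norm_apply_le _ _
            · exact PiLp.norm_apply_le _ _
        _ = _ := by ring
    have hone : ∀ m, ∫ ω, r m ω * (‖a ω‖ ^ 2 * (a ω m * g ω m)) ∂P
        = (1 - ρ) * ∫ ω, ‖a ω‖ ^ 2 * (a ω m * g ω m) ∂P := fun m => by
      have hX : Measurable[𝓕 ⊔ MeasurableSpace.comap g inferInstance]
          (fun ω => ‖a ω‖ ^ 2 * (a ω m * g ω m)) := by
        have h1 : Measurable[𝓕 ⊔ MeasurableSpace.comap g inferInstance] a :=
          ha.mono le_sup_left le_rfl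
        have h2 : Measurable[𝓕 ⊔ MeasurableSpace.comap g inferInstance] g :=
          (comap_measurable g).mono le_sup_right le_rfl
        fun_prop
      have hind : IndepFun (r m) (fun ω => ‖a ω‖ ^ 2 * (a ω m * g ω m)) P :=
        indep_of_indep_of_le_right (hindep m) hX.comap_le
      rw [hind.integral_fun_mul_eq_mul_integral (hr m).aestronglyMeasurable
        (hint m).aestronglyMeasurable,
        integral_indicator_variable (hr m) (hr01 m) hρ (hrP m)]
    have hintr : ∀ m, Integrable (fun ω => r m ω * (‖a ω‖ ^ 2 * (a ω m * g ω m))) P := fun m =>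
      (hint m).bdd_mul (c := 1) (hr m).aestronglyMeasurable (Eventually.of_forall fun ω => by
        rcases hr01 m ω with h | h <;> simp [h])
    calc ∫ ω, ‖a ω‖ ^ 2 * ⟪a ω, mask (fun m => r m ω) (g ω)⟫ ∂P
        = ∫ ω, ∑ m, r m ω * (‖a ω‖ ^ 2 * (a ω m * g ω m)) ∂P := by
          refine integral_congr_ae (Eventually.of_forall fun ω => ?_)
          simp only [hcoord, mask_apply, Finset.mul_sum]
          exact Finset.sum_congr rfl fun m _ => by ring
      _ = (1 - ρ) * ∫ ω, ∑ m, ‖a ω‖ ^ 2 * (a ω m * g ω m) ∂P := by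
          rw [integral_finsetSum _ fun m _ => hintr m, integral_finsetSum _ fun m _ => hint m,
            Finset.mul_sum]
          exact Finset.sum_congr rfl fun m _ => hone m
      _ = _ := by simp only [hcoord, Finset.mul_sum]
  have hnoise : ∫ ω, ‖a ω‖ ^ 2 * ⟪a ω, (g - h) ω⟫ ∂P = 0 := by
    have hpull := condExp_bilin_of_stronglyMeasurable_left (μ := P) (innerSL ℝ (E := Vec M))
      (m := 𝓕) (f := fun ω => ‖a ω‖ ^ 2 • a ω) (g := g - h)
      (by
        have : Measurable[𝓕] (fun ω => ‖a ω‖ ^ 2 • a ω) := by fun_prop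
        exact this.stronglyMeasurable)
      (by
        refine (integrable_norm_sq_mul_inner ha4 (hg4.sub hh4)).congr
          (Eventually.of_forall fun ω => ?_)
        exact (real_inner_smul_left _ _ _).symm)
      ((hg4.sub hh4).integrable (by norm_num))
    calc ∫ ω, ‖a ω‖ ^ 2 * ⟪a ω, (g - h) ω⟫ ∂P
        = ∫ ω, innerSL ℝ (‖a ω‖ ^ 2 • a ω) ((g - h) ω) ∂P := by
          refine integral_congr_ae (Eventually.of_forall fun ω => ?_)
          simp only [innerSL_apply_apply, real_inner_smul_left]
      _ = ∫ ω, (P[fun ω => innerSL ℝ (‖a ω‖ ^ 2 • a ω) ((g - h) ω) | 𝓕]) ω ∂P :=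
          (integral_condExp h𝓕).symm
      _ = ∫ ω, (0 : ℝ) ∂P := by
          refine integral_congr_ae ?_
          filter_upwards [hpull, hcond] with ω h1 h2
          rw [h1, h2]
          simp
      _ = 0 := integral_zero _ _
  have hmg4 : MemLp (fun ω => mask (fun m => r m ω) (g ω)) 4 P :=
    memLp_mask hr hr01 hg hg4
  have e1 := integrable_norm_sq_mul_inner ha4 hmg4
  have e2 := (integrable_norm_sq_mul_inner ha4 hh4)
  have e3 := (integrable_norm_sq_mul_inner ha4 hg4)
  simp only [Pi.sub_apply, inner_sub_right, mul_sub] at hnoise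
  rw [integral_sub e3 e2] at hnoise
  calc ∫ ω, ‖a ω‖ ^ 2 * ⟪a ω, mask (fun m => r m ω) (g ω) - (1 - ρ) • h ω⟫ ∂P
      = ∫ ω, (‖a ω‖ ^ 2 * ⟪a ω, mask (fun m => r m ω) (g ω)⟫
          - (1 - ρ) * (‖a ω‖ ^ 2 * ⟪a ω, h ω⟫)) ∂P := by
        refine integral_congr_ae (Eventually.of_forall fun ω => ?_)
        simp only [inner_sub_right, real_inner_smul_right]
        ring
    _ = (1 - ρ) * (∫ ω, ‖a ω‖ ^ 2 * ⟪a ω, g ω⟫ ∂P - ∫ ω, ‖a ω‖ ^ 2 * ⟪a ω, h ω⟫ ∂P) := by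
        rw [integral_sub e1 (e2.const_mul _), hmask, integral_const_mul]
        ring
    _ = 0 := by rw [hnoise, mul_zero]

end MaskedNoise

/-! ### Stability of perturbed averaging in a normed space -/

section Stability

variable {ι : Type*} [Fintype ι]

/-- The step sizes enter an agent's state only through the combination matrix, so that their total
effect is controlled by the Perron-weighted step size `∑_l (A p)_l μ_l`. In particular, no lower
bound on the ratios of the individual step sizes is needed. -/
lemma sum_mul_stepSize_le {A : Matrix ι ι ℝ} (hA : IsLeftStochastic A) {p μ : ι → ℝ} {π : ℝ}
    (hπ : 0 < π) (hp : ∀ k, π ≤ p k) (hμ : ∀ l, 0 ≤ μ l) (k : ι) :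
    ∑ l, A l k * μ l ≤ (∑ l, A.mulVec p l * μ l) / π := by
  rw [le_div_iff₀ hπ, Finset.sum_mul]
  refine Finset.sum_le_sum fun l _ => ?_
  have h : A l k * π ≤ A.mulVec p l :=
    (mul_le_mul_of_nonneg_left (hp k) (hA.nonneg l k)).trans
      (Finset.single_le_sum (f := fun j => A l j * p j)
        (fun j _ => mul_nonneg (hA.nonneg l j) (hπ.le.trans (hp j))) (Finset.mem_univ k))
  calc A l k * μ l * π = A l k * π * μ l := by ring
    _ ≤ _ := mul_le_mul_of_nonneg_right h (hμ l)

/-- Stability of the combine–adapt–combine recursion in a normed space: if the weighted average is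
contracted at a rate proportional to the weighted step size `s`, up to a perturbation caused by the
disagreement and an input of order `s²` in the squared norm, then the error is eventually of
order `√s`. -/
lemma exists_eventually_norm_sq_le [DecidableEq ι] [Nonempty ι] {A₁ A₂ : Matrix ι ι ℝ}
    (hA₁ : IsLeftStochastic A₁) (hA₂ : IsLeftStochastic A₂) (hprim : (A₁ * A₂).IsPrimitive)
    {p : ι → ℝ} (hp0 : ∀ k, 0 < p k) (hp : ∑ k, p k = 1) (hpA : (A₁ * A₂).mulVec p = p)
    {κ δ L : ℝ} (hκ : 0 < κ) (hδ : 0 ≤ δ) (hL : 0 ≤ L) :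
    ∃ C s₀ : ℝ, 0 < C ∧ 0 < s₀ ∧ ∀ (E : Type*) [NormedAddCommGroup E] [NormedSpace ℝ E]
      (μ : ι → ℝ) (s : ℝ), (∀ l, 0 ≤ μ l) → s = ∑ l, A₂.mulVec p l * μ l → 0 < s → s < s₀ →
      ∀ x g : ℕ → ι → E,
      (∀ i, x (i + 1) = mix A₂ (mix A₁ (x i) - fun l => μ l • g i l)) →
      (∀ i, ‖g i‖ ≤ L * (‖x i‖ + 1)) →
      (∀ i, ‖centroid p (x (i + 1))‖ ^ 2
        ≤ ((1 - κ * s) * ‖centroid p (x i)‖ + δ * s * ‖deviation p (x i)‖) ^ 2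
          + 4 * (s * (L * (‖x i‖ + 1))) ^ 2) →
      ∀ᶠ i in atTop, ‖x i‖ ^ 2 ≤ C * s := by
  obtain ⟨n, θ, hθ, hθ1, hcontr⟩ := exists_disagreement_contraction (hA₁.mul hA₂) hprim
    (fun k => (hp0 k).le) hp hpA
  obtain ⟨k₀, -, hk₀⟩ := Finset.exists_min_image Finset.univ p Finset.univ_nonempty
  set π := p k₀
  have hπ : 0 < π := hp0 k₀
  have hpπ : ∀ k, π ≤ p k := fun k => hk₀ k (Finset.mem_univ k)
  set b : ℝ := (θ ^ n)⁻¹ with hb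
  have hθn : 0 < θ ^ n := pow_pos hθ n
  have hb1 : 1 ≤ b := (one_le_inv₀ hθn).mpr (pow_le_one₀ hθ.le hθ1.le)
  obtain ⟨C, s₁, hC, hs₁, H⟩ := exists_eventually_sq_le (κ := κ) (θ := θ) (D := δ * b)
    (G := 4 * (L * b) ^ 2) (K := 2 * (n + 1) / π * (L * b)) (b := b) hκ hθ.le hθ1 (by positivity)
  refine ⟨C, min s₁ (1 / κ), hC, lt_min hs₁ (by positivity), ?_⟩
  intro E _ _ μ s hμ hs hs0 hs1 x g hx hg hc
  have hκs : κ * s < 1 := by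
    have := lt_of_lt_of_le hs1 (min_le_right _ _)
    rw [lt_div_iff₀ hκ] at this
    linarith
  have hη0 : ∀ i, 0 ≤ disagreement (A₁ * A₂) p n θ (x i) := fun i => disagreement_nonneg hθ.le _
  have hdev : ∀ i, ‖deviation p (x i)‖ ≤ b * disagreement (A₁ * A₂) p n θ (x i) := fun i => by
    rw [hb, ← div_eq_inv_mul, le_div_iff₀ hθn, mul_comm]
    exact norm_deviation_le_disagreement hθ.le (x i)
  have hnorm : ∀ i, ‖x i‖ ≤ ‖centroid p (x i)‖ + b * disagreement (A₁ * A₂) p n θ (x i) :=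
    fun i => by
      have h1 : x i = (fun _ => centroid p (x i)) + deviation p (x i) := by
        rw [deviation_apply]; abel
      have h2 : ‖(fun _ : ι => centroid p (x i))‖ ≤ ‖centroid p (x i)‖ :=
        (pi_norm_le_iff_of_nonneg (norm_nonneg _)).mpr fun _ => le_rfl
      calc ‖x i‖ ≤ ‖(fun _ : ι => centroid p (x i))‖ + ‖deviation p (x i)‖ := by
            conv_lhs => rw [h1]
            exact norm_add_le _ _
        _ ≤ _ := add_le_add h2 (hdev i)
  have hinput : ∀ i, L * (‖x i‖ + 1) ≤ L * b *
      (‖centroid p (x i)‖ + disagreement (A₁ * A₂) p n θ (x i) + 1) := fun i => by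
    rw [mul_assoc]
    refine mul_le_mul_of_nonneg_left ?_ hL
    nlinarith [hnorm i, norm_nonneg (centroid p (x i)), hη0 i]
  have hα : ∀ i, ‖centroid p (x (i + 1))‖ ^ 2
      ≤ ((1 - κ * s) * ‖centroid p (x i)‖
          + δ * b * s * disagreement (A₁ * A₂) p n θ (x i)) ^ 2
        + 4 * (L * b) ^ 2 * s ^ 2 *
          (‖centroid p (x i)‖ + disagreement (A₁ * A₂) p n θ (x i) + 1) ^ 2 := fun i => by
    refine (hc i).trans (add_le_add (pow_le_pow_left₀ ?_ ?_ 2) ?_)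
    · have : 0 ≤ 1 - κ * s := by linarith
      positivity
    · have := mul_le_mul_of_nonneg_left (hdev i) (mul_nonneg hδ hs0.le)
      linarith
    · calc 4 * (s * (L * (‖x i‖ + 1))) ^ 2
          ≤ 4 * (s * (L * b * (‖centroid p (x i)‖
              + disagreement (A₁ * A₂) p n θ (x i) + 1))) ^ 2 := by
            gcongr 4 * (s * ?_) ^ 2
            exact hinput i
        _ = _ := by ring
  have hη : ∀ i, disagreement (A₁ * A₂) p n θ (x (i + 1))
      ≤ θ * disagreement (A₁ * A₂) p n θ (x i) + 2 * (n + 1) / π * (L * b) * s *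
        (‖centroid p (x i)‖ + disagreement (A₁ * A₂) p n θ (x i) + 1) := fun i => by
    have hd : ‖mix A₂ (fun l => μ l • g i l)‖ ≤ s / π * ‖g i‖ := by
      refine (pi_norm_le_iff_of_nonneg (by positivity)).mpr fun k => ?_
      calc ‖mix A₂ (fun l => μ l • g i l) k‖ ≤ ∑ l, ‖A₂ l k • μ l • g i l‖ := norm_sum_le _ _
        _ ≤ ∑ l, A₂ l k * μ l * ‖g i‖ := Finset.sum_le_sum fun l _ => by
            rw [norm_smul, norm_smul, Real.norm_of_nonneg (hA₂.nonneg l k),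
              Real.norm_of_nonneg (hμ l), ← mul_assoc]
            exact mul_le_mul_of_nonneg_left (norm_le_pi_norm _ l)
              (mul_nonneg (hA₂.nonneg l k) (hμ l))
        _ ≤ s / π * ‖g i‖ := by
            rw [← Finset.sum_mul, hs]
            exact mul_le_mul_of_nonneg_right (sum_mul_stepSize_le hA₂ hπ hpπ hμ k)
              (norm_nonneg _)
    rw [hx i, map_sub, ← mix_mul]
    refine (disagreement_sub_le hθ.le _ _).trans (add_le_add (hcontr _) ?_)
    calc disagreement (A₁ * A₂) p n θ (mix A₂ fun l => μ l • g i l)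
        ≤ 2 * (n + 1) * ‖mix A₂ (fun l => μ l • g i l)‖ :=
          disagreement_le (hA₁.mul hA₂) (fun k => (hp0 k).le) hp hθ.le hθ1.le _
      _ ≤ 2 * (n + 1) * (s / π * (L * b *
          (‖centroid p (x i)‖ + disagreement (A₁ * A₂) p n θ (x i) + 1))) := by
          gcongr
          exact hd.trans (mul_le_mul_of_nonneg_left ((hg i).trans (hinput i)) (by positivity))
      _ = _ := by ring
  filter_upwards [H s hs0 (lt_of_lt_of_le hs1 (min_le_left _ _)) _ _ hη0 hα hη] with i hi
  exact (pow_le_pow_left₀ (norm_nonneg _) (hnorm i) 2).trans hi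

end Stability

section Lp

variable {Ω : Type*} {m0 : MeasurableSpace Ω} {P : Measure Ω} {E : Type*} [NormedAddCommGroup E]

lemma norm_toLp_eq_lpNorm {f : Ω → E} (hf : MemLp f 4 P) : ‖hf.toLp f‖ = lpNorm f 4 P := by
  rw [Lp.norm_toLp, toReal_eLpNorm hf.1]

lemma toLp_sum_smul [NormedSpace ℝ E] {ι : Type*} (t : Finset ι) (c : ι → ℝ) {f : ι → Ω → E}
    (hf : ∀ l, MemLp (f l) 4 P) (h : MemLp (fun ω => ∑ l ∈ t, c l • f l ω) 4 P) :
    h.toLp _ = ∑ l ∈ t, c l • (hf l).toLp (f l) := by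
  classical
  induction t using Finset.induction_on with
  | empty =>
    simp only [Finset.sum_empty]
    exact MemLp.toLp_zero _
  | insert l t hl ih =>
    have ht : MemLp (fun ω => ∑ l ∈ t, c l • f l ω) 4 P :=
      memLp_finsetSum t fun l _ => (hf l).const_smul (c l)
    rw [Finset.sum_insert hl, ← ih ht, ← MemLp.toLp_const_smul, ← MemLp.toLp_add]
    congr 1
    ext ω
    simp [Finset.sum_insert hl]

end Lp

/-! ### Gradient noise and the weighted average of the errors -/

section Noise

open scoped RealInnerProductSpace

lemma approxGrad_eq {N M : ℕ} {Ω : Type*} {D : Inputs N M Ω} {i : ℕ} {k : Fin N}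
    (J : Fin N → Vec M → ℝ) (w : Ω → Vec M) :
    (fun ω => D.approxGrad k i (w ω) ω)
      = gradNoise J D k i w + fun ω => gradient (J k) (w ω) := by
  funext ω
  simp [gradNoise]

variable {N M : ℕ} {Ω : Type*} [m0 : MeasurableSpace Ω] {P : Measure Ω}
  {D : Inputs N M Ω} {J : Fin N → Vec M → ℝ} {ν δ : ℝ} {wo : Vec M} {r β σ : Fin N → ℝ}
  {𝓕 : ℕ → MeasurableSpace Ω} {i : ℕ} {k : Fin N} {w : Ω → Vec M}

lemma norm_gradient_le (hJ : HasHessianBounds ν δ (J k)) (hν : 0 ≤ ν) (hδ : 0 ≤ δ)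
    (hwo : ∀ v, J k wo ≤ J k v) (v : Vec M) : ‖gradient (J k) v‖ ≤ δ * ‖v - wo‖ := by
  have := hJ.norm_gradient_sub_le hν hδ v wo
  rwa [gradient_eq_zero_of_minimizer hwo, sub_zero] at this

lemma measurable_approxGrad (hreg : IsRegular P D) (hw : Measurable w) :
    Measurable (fun ω => D.approxGrad k i (w ω) ω) :=
  (hreg.measurable_approxGrad k i).comp (hw.prodMk measurable_id)

variable [IsProbabilityMeasure P]

lemma memLp_sub_const (hw : MemLp w 4 P) : MemLp (fun ω => w ω - wo) 4 P :=
  hw.sub (memLp_const wo)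

lemma memLp_gradient (hJ : HasHessianBounds ν δ (J k)) (hν : 0 ≤ ν) (hδ : 0 ≤ δ)
    (hwo : ∀ v, J k wo ≤ J k v) (hw : MemLp w 4 P) :
    MemLp (fun ω => gradient (J k) (w ω)) 4 P :=
  (memLp_sub_const (wo := wo) hw).of_le_mul
    (hJ.continuous_gradient.comp_aestronglyMeasurable hw.1)
    (Eventually.of_forall fun ω => norm_gradient_le hJ hν hδ hwo (w ω))

/-- The unconditional form of the bound on the fourth moment of the gradient noise. -/
lemma lpNorm_gradNoise_le (h𝓕 : 𝓕 i ≤ m0) (hN : NoiseConditions P J β σ 𝓕 D) (hβ : 0 ≤ β k)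
    (hσ : 0 ≤ σ k) (hw : IsIterate P (𝓕 i) w) :
    lpNorm (gradNoise J D k i w) 4 P ≤ β k * lpNorm w 4 P + σ k := by
  have hs := hN.memLp i k w hw
  have hwi := (integrable_norm_pow_four hw.memLp).const_mul (β k ^ 4)
  have h4 : lpNorm (gradNoise J D k i w) 4 P ^ 4 ≤ (β k * lpNorm w 4 P) ^ 4 + σ k ^ 4 := by
    rw [lpNorm_four_pow hs, mul_pow, lpNorm_four_pow hw.memLp]
    calc ∫ ω, ‖gradNoise J D k i w ω‖ ^ 4 ∂P
        = ∫ ω, (P[fun ω => ‖gradNoise J D k i w ω‖ ^ 4 | 𝓕 i]) ω ∂P := (integral_condExp h𝓕).symm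
      _ ≤ ∫ ω, (β k ^ 4 * ‖w ω‖ ^ 4 + σ k ^ 4) ∂P :=
          integral_mono_ae integrable_condExp (hwi.add (integrable_const _))
            (hN.fourth_moment i k w hw)
      _ = _ := by
          rw [integral_add hwi (integrable_const _), integral_const_mul]
          simp
  have hx : 0 ≤ β k * lpNorm w 4 P := mul_nonneg hβ lpNorm_nonneg
  refine le_of_pow_le_pow_left₀ (n := 4) (by norm_num) (by positivity) (h4.trans ?_)
  have h5 : (β k * lpNorm w 4 P + σ k) ^ 4 - ((β k * lpNorm w 4 P) ^ 4 + σ k ^ 4)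
      = 4 * (β k * lpNorm w 4 P) ^ 3 * σ k + 6 * (β k * lpNorm w 4 P) ^ 2 * σ k ^ 2
        + 4 * (β k * lpNorm w 4 P) * σ k ^ 3 := by ring
  have : 0 ≤ 4 * (β k * lpNorm w 4 P) ^ 3 * σ k + 6 * (β k * lpNorm w 4 P) ^ 2 * σ k ^ 2
        + 4 * (β k * lpNorm w 4 P) * σ k ^ 3 := by positivity
  linarith

lemma lpNorm_gradient_le (hJ : HasHessianBounds ν δ (J k)) (hν : 0 ≤ ν) (hδ : 0 ≤ δ)
    (hwo : ∀ v, J k wo ≤ J k v) (hw : MemLp w 4 P) :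
    lpNorm (fun ω => gradient (J k) (w ω)) 4 P ≤ δ * lpNorm (fun ω => w ω - wo) 4 P :=
  lpNorm_le_mul_of_norm_le hδ (memLp_sub_const hw) fun ω => norm_gradient_le hJ hν hδ hwo (w ω)

lemma memLp_approxGrad (hN : NoiseConditions P J β σ 𝓕 D) (hJ : HasHessianBounds ν δ (J k))
    (hν : 0 ≤ ν) (hδ : 0 ≤ δ) (hwo : ∀ v, J k wo ≤ J k v) (hw : IsIterate P (𝓕 i) w) :
    MemLp (fun ω => D.approxGrad k i (w ω) ω) 4 P := by
  rw [approxGrad_eq J]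
  exact (hN.memLp i k w hw).add (memLp_gradient hJ hν hδ hwo hw.memLp)

lemma lpNorm_approxGrad_le (h𝓕 : 𝓕 i ≤ m0) (hN : NoiseConditions P J β σ 𝓕 D)
    (hJ : HasHessianBounds ν δ (J k)) (hν : 0 ≤ ν) (hδ : 0 ≤ δ) (hwo : ∀ v, J k wo ≤ J k v)
    (hβ : 0 ≤ β k) (hσ : 0 ≤ σ k) (hw : IsIterate P (𝓕 i) w) :
    lpNorm (fun ω => D.approxGrad k i (w ω) ω) 4 P
      ≤ (δ + β k) * lpNorm (fun ω => w ω - wo) 4 P + (β k * ‖wo‖ + σ k) := by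
  have h1 := lpNorm_gradient_le hJ hν hδ hwo hw.memLp
  have h2 := lpNorm_gradNoise_le h𝓕 hN hβ hσ hw
  have h3 : lpNorm w 4 P ≤ lpNorm (fun ω => w ω - wo) 4 P + ‖wo‖ := by
    have hsum : w = (fun ω => w ω - wo) + fun _ => wo := by funext ω; simp
    have := lpNorm_add_le (μ := P) (p := 4) (g := fun _ => wo)
      (memLp_sub_const (wo := wo) hw.memLp) (by norm_num)
    rw [← hsum, lpNorm_const (by norm_num) (NeZero.ne P)] at this
    simpa using this
  rw [approxGrad_eq J]
  have h4 := lpNorm_add_le (g := fun ω => gradient (J k) (w ω)) (hN.memLp i k w hw)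
    (by norm_num : (1 : ℝ≥0∞) ≤ 4)
  nlinarith [mul_le_mul_of_nonneg_left h3 hβ]

/-- One step of the weighted average of the errors, in `L⁴`: the drift contracts, the evaluation of
the gradients away from the average costs a multiple of `s`, and the noise enters the squared norm
with the factor `s²` because it is a martingale increment. -/
lemma lpNorm_centroid_step_sq_le (h𝓕 : 𝓕 i ≤ m0) (hreg : IsRegular P D)
    (hI : IndicatorConditions P r 𝓕 D) (hN : NoiseConditions P J β σ 𝓕 D)
    (hJ : ∀ l, HasHessianBounds ν δ (J l)) (hν : 0 ≤ ν) (hδ : 0 ≤ δ)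
    (hwo : ∀ l v, J l wo ≤ J l v) {ρ : ℝ} (hρ : 0 ≤ ρ) (hr : ∀ l, 0 ≤ r l)
    (hrρ : ∀ l, ρ ≤ 1 - r l) {u : Fin N → ℝ} (hu : ∀ l, 0 ≤ u l)
    (hs1 : ρ * ν / 2 * ∑ l, u l ≤ 1) (hs2 : δ ^ 2 * ∑ l, u l ≤ ρ * ν)
    {φ : Fin N → Ω → Vec M} {c : Ω → Vec M} (hφ : ∀ l, IsIterate P (𝓕 i) (φ l))
    (hc : IsIterate P (𝓕 i) c) {B Z : ℝ}
    (hB : ∀ l, lpNorm (fun ω => D.approxGrad l i (φ l ω) ω) 4 P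
      + lpNorm (fun ω => gradient (J l) (φ l ω)) 4 P ≤ B)
    (hZ : ∀ l, lpNorm (fun ω => φ l ω - wo - c ω) 4 P ≤ Z) :
    lpNorm (fun ω => c ω - ∑ l, u l • mask (fun m => D.indicator l i m ω)
        (D.approxGrad l i (φ l ω) ω)) 4 P ^ 2
      ≤ ((1 - ρ * ν / 2 * ∑ l, u l) * lpNorm c 4 P + δ * (∑ l, u l) * Z) ^ 2
        + 4 * ((∑ l, u l) * B) ^ 2 := by
  have hgm : ∀ l, Measurable (fun ω => D.approxGrad l i (φ l ω) ω) := fun l =>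
    measurable_approxGrad hreg ((hφ l).measurable.mono h𝓕 le_rfl)
  have hg4 : ∀ l, MemLp (fun ω => D.approxGrad l i (φ l ω) ω) 4 P := fun l =>
    memLp_approxGrad hN (hJ l) hν hδ (hwo l) (hφ l)
  have hh4 : ∀ l, MemLp (fun ω => gradient (J l) (φ l ω)) 4 P := fun l =>
    memLp_gradient (hJ l) hν hδ (hwo l) (hφ l).memLp
  have hm4 : ∀ l, MemLp (fun ω => mask (fun m => D.indicator l i m ω)
      (D.approxGrad l i (φ l ω) ω)) 4 P := fun l =>
    memLp_mask (fun m => hreg.measurable_indicator l i m) (fun m => hI.zero_or_one l i m) (hgm l)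
      (hg4 l)
  have hr1 : ∀ l, 1 - r l ≤ 1 := fun l => by linarith [hr l]
  set a : Ω → Vec M := fun ω => c ω - ∑ l, (u l * (1 - r l)) • gradient (J l) (φ l ω) with ha_def
  set v : Fin N → Ω → Vec M := fun l ω => mask (fun m => D.indicator l i m ω)
    (D.approxGrad l i (φ l ω) ω) - (1 - r l) • gradient (J l) (φ l ω) with hv_def
  have hv4 : ∀ l, MemLp (v l) 4 P := fun l => (hm4 l).sub ((hh4 l).const_smul (1 - r l))
  set n : Ω → Vec M := fun ω => ∑ l, u l • v l ω with hn_def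
  have hn4 : MemLp n 4 P := memLp_finsetSum _ fun l _ => (hv4 l).const_smul (u l)
  have ha4 : MemLp a 4 P :=
    hc.memLp.sub (memLp_finsetSum _ fun l _ => (hh4 l).const_smul (u l * (1 - r l)))
  have ham : Measurable[𝓕 i] a := by
    refine hc.measurable.sub (Finset.measurable_fun_sum _ fun l _ => ?_)
    exact ((hJ l).continuous_gradient.measurable.comp (hφ l).measurable).const_smul
      (u l * (1 - r l))
  have hsplit : (fun ω => c ω - ∑ l, u l • mask (fun m => D.indicator l i m ω)
      (D.approxGrad l i (φ l ω) ω)) = a - n := by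
    funext ω
    simp only [ha_def, hn_def, hv_def, Pi.sub_apply, smul_sub, smul_smul,
      Finset.sum_sub_distrib]
    abel
  have horth : ∫ ω, ‖a ω‖ ^ 2 * ⟪a ω, n ω⟫ ∂P = 0 := by
    have hint : ∀ l, Integrable (fun ω => u l * (‖a ω‖ ^ 2 * ⟪a ω, v l ω⟫)) P := fun l =>
      (integrable_norm_sq_mul_inner ha4 (hv4 l)).const_mul (u l)
    calc ∫ ω, ‖a ω‖ ^ 2 * ⟪a ω, n ω⟫ ∂P
        = ∫ ω, ∑ l, u l * (‖a ω‖ ^ 2 * ⟪a ω, v l ω⟫) ∂P := by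
          refine integral_congr_ae (Eventually.of_forall fun ω => ?_)
          simp only [hn_def, inner_sum, real_inner_smul_right, Finset.mul_sum]
          exact Finset.sum_congr rfl fun l _ => by ring
      _ = 0 := by
          rw [integral_finsetSum _ fun l _ => hint l]
          refine Finset.sum_eq_zero fun l _ => ?_
          rw [integral_const_mul, integral_norm_sq_mul_inner_mask_sub h𝓕 ham ha4 (hgm l) (hg4 l)
            (hh4 l) (hN.mean_zero i l (φ l) (hφ l))
            (fun m => hreg.measurable_indicator l i m) (fun m => hI.zero_or_one l i m) (hr l)
            (fun m => hI.prob_zero l i m) fun m => ?_, mul_zero]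
          exact indep_of_indep_of_le_left (hI.indep_past i l (φ l) (hφ l))
            (le_iSup₂_of_le l m le_rfl)
  have hnB : lpNorm n 4 P ≤ (∑ l, u l) * B := by
    have hn_sum : n = ∑ l, u l • v l := by funext ω; simp [hn_def]
    rw [hn_sum, Finset.sum_mul]
    refine (lpNorm_sum_le (fun l _ => (hv4 l).const_smul (u l)) (by norm_num)).trans
      (Finset.sum_le_sum fun l _ => ?_)
    rw [lpNorm_const_smul, coe_nnnorm, Real.norm_of_nonneg (hu l)]
    refine mul_le_mul_of_nonneg_left (le_trans ?_ (hB l)) (hu l)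
    refine (lpNorm_sub_le (hm4 l) (by norm_num)).trans (add_le_add ?_ ?_)
    · simpa using lpNorm_le_mul_of_norm_le zero_le_one (hg4 l) fun ω => by
        rw [one_mul]; exact norm_mask_le (fun m => hI.zero_or_one l i m ω) _
    · simpa using lpNorm_le_mul_of_norm_le (f := fun ω => (1 - r l) • gradient (J l) (φ l ω))
        zero_le_one (hh4 l) fun ω => by
          rw [norm_smul, Real.norm_of_nonneg (hρ.trans (hrρ l))]
          exact mul_le_mul_of_nonneg_right (hr1 l) (norm_nonneg _)
  have hstep : ∀ ω, ‖a ω‖ ≤ (1 - ρ * ν / 2 * ∑ l, u l) * ‖c ω‖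
      + ∑ l, u l * (δ * ‖φ l ω - wo - c ω‖) := fun ω => by
    have hgrad0 : ∀ l, gradient (J l) wo = 0 := fun l => gradient_eq_zero_of_minimizer (hwo l)
    have := norm_centroid_step_le (G := fun l x => gradient (J l) (x + wo))
      (t := fun l => 1 - r l) (u := u) (ν := ν) (δ := δ) (ρ := ρ) hν hu hrρ hr1 hρ
      (fun l x => by
        simpa [hgrad0] using (hJ l).inner_gradient_sub_ge (x + wo) wo)
      (fun l => by simp [hgrad0])
      (fun l x y => by simpa using (hJ l).norm_gradient_sub_le hν hδ (x + wo) (y + wo))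
      hs1 hs2 (c ω) (fun l => φ l ω - wo)
    simpa [ha_def] using this
  have hd4 : ∀ l, MemLp (fun ω => φ l ω - wo - c ω) 4 P := fun l =>
    (memLp_sub_const (hφ l).memLp).sub hc.memLp
  have haB : lpNorm a 4 P
      ≤ (1 - ρ * ν / 2 * ∑ l, u l) * lpNorm c 4 P + δ * (∑ l, u l) * Z := by
    have hcn : MemLp ((1 - ρ * ν / 2 * ∑ l, u l) • fun ω => ‖c ω‖) 4 P :=
      hc.memLp.norm.const_smul _
    have hdn : ∀ l, MemLp ((u l * δ) • fun ω => ‖φ l ω - wo - c ω‖) 4 P := fun l =>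
      (hd4 l).norm.const_smul _
    calc lpNorm a 4 P
        ≤ lpNorm (((1 - ρ * ν / 2 * ∑ l, u l) • fun ω => ‖c ω‖)
            + ∑ l, (u l * δ) • fun ω => ‖φ l ω - wo - c ω‖) 4 P := by
          refine lpNorm_mono_real (hcn.add (memLp_finsetSum' _ fun l _ => hdn l)) fun ω => ?_
          simpa [mul_assoc] using hstep ω
      _ ≤ lpNorm ((1 - ρ * ν / 2 * ∑ l, u l) • fun ω => ‖c ω‖) 4 P
            + ∑ l, lpNorm ((u l * δ) • fun ω => ‖φ l ω - wo - c ω‖) 4 P :=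
          (lpNorm_add_le hcn (by norm_num)).trans
            (add_le_add le_rfl (lpNorm_sum_le (fun l _ => hdn l) (by norm_num)))
      _ ≤ _ := by
          refine add_le_add (le_of_eq ?_) ?_
          · rw [lpNorm_const_smul, lpNorm_norm hc.memLp.1, coe_nnnorm,
              Real.norm_of_nonneg (by linarith)]
          · rw [mul_comm δ, mul_assoc, Finset.sum_mul]
            refine Finset.sum_le_sum fun l _ => ?_
            rw [lpNorm_const_smul, lpNorm_norm (hd4 l).1, coe_nnnorm,
              Real.norm_of_nonneg (mul_nonneg (hu l) hδ), mul_assoc]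
            exact mul_le_mul_of_nonneg_left (mul_le_mul_of_nonneg_left (hZ l) hδ) (hu l)
  rw [hsplit]
  refine (lpNorm_four_sub_sq_le ha4 hn4 horth).trans (add_le_add ?_ ?_)
  · exact pow_le_pow_left₀ lpNorm_nonneg haB 2
  · exact mul_le_mul_of_nonneg_left (pow_le_pow_left₀ lpNorm_nonneg hnB 2) (by norm_num)

end Noise

/-! ### The iterates of the algorithm -/

section Iterates

variable {N M : ℕ} {nbr : Fin N → Finset (Fin N)} {A A₁ A₂ : Matrix (Fin N) (Fin N) ℝ}

lemma IsCombinationMatrix.isLeftStochastic (hA : IsCombinationMatrix nbr A) :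
    IsLeftStochastic A := ⟨hA.nonneg, hA.col_sum⟩

lemma IsCombinationMatrix.combine_eq_mix (hA : IsCombinationMatrix nbr A) (w : Fin N → Vec M)
    (k : Fin N) : combine nbr A w k = mix A w k :=
  Finset.sum_subset (Finset.subset_univ _) fun l _ hl => by rw [hA.support l k hl, zero_smul]

variable {Ω : Type*} {μ : Fin N → ℝ} {D : Inputs N M Ω}

/-- The intermediate iterate `φ_{l,i-1}`. -/
noncomputable def preIterate (nbr : Fin N → Finset (Fin N))
    (A₁ A₂ : Matrix (Fin N) (Fin N) ℝ) (μ : Fin N → ℝ) (D : Inputs N M Ω) (i : ℕ) (l : Fin N) (ω : Ω) : Vec M :=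
  mix A₁ (fun j => iterate nbr A₁ A₂ μ D i j ω) l

/-- The masked approximate gradient `Γ_{l,i} ĝ_{l,i}(φ_{l,i-1})`. -/
noncomputable def maskedGrad (nbr : Fin N → Finset (Fin N))
    (A₁ A₂ : Matrix (Fin N) (Fin N) ℝ) (μ : Fin N → ℝ) (D : Inputs N M Ω) (i : ℕ) (l : Fin N) (ω : Ω) : Vec M :=
  mask (fun m => D.indicator l i m ω) (D.approxGrad l i (preIterate nbr A₁ A₂ μ D i l ω) ω)

lemma iterate_succ (hA₁ : IsCombinationMatrix nbr A₁) (hA₂ : IsCombinationMatrix nbr A₂) (i : ℕ)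
    (k : Fin N) (ω : Ω) :
    iterate nbr A₁ A₂ μ D (i + 1) k ω = mix A₂ (fun l => preIterate nbr A₁ A₂ μ D i l ω
      - μ l • maskedGrad nbr A₁ A₂ μ D i l ω) k := by
  have h : ∀ l, combine nbr A₁ (fun j => iterate nbr A₁ A₂ μ D i j ω) l
      = preIterate nbr A₁ A₂ μ D i l ω := fun l => hA₁.combine_eq_mix _ l
  rw [← hA₂.combine_eq_mix]
  simp only [maskedGrad, ← h]
  rfl

lemma preIterate_sub (hA₁ : IsCombinationMatrix nbr A₁) (wo : Vec M) (i : ℕ) (l : Fin N) (ω : Ω) :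
    preIterate nbr A₁ A₂ μ D i l ω - wo
      = mix A₁ (fun j => iterate nbr A₁ A₂ μ D i j ω - wo) l := by
  have h := map_sub (mix A₁) (fun j => iterate nbr A₁ A₂ μ D i j ω) (fun _ => wo)
  rw [mix_const hA₁.isLeftStochastic] at h
  exact (congrFun h l).symm

lemma iterate_succ_sub (hA₁ : IsCombinationMatrix nbr A₁) (hA₂ : IsCombinationMatrix nbr A₂)
    (wo : Vec M) (i : ℕ) (k : Fin N) (ω : Ω) :
    iterate nbr A₁ A₂ μ D (i + 1) k ω - wo = mix A₂ (fun l =>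
      mix A₁ (fun j => iterate nbr A₁ A₂ μ D i j ω - wo) l
        - μ l • maskedGrad nbr A₁ A₂ μ D i l ω) k := by
  have h := map_sub (mix A₂) (fun l => preIterate nbr A₁ A₂ μ D i l ω
      - μ l • maskedGrad nbr A₁ A₂ μ D i l ω) (fun _ => wo)
  rw [mix_const hA₂.isLeftStochastic] at h
  rw [iterate_succ hA₁ hA₂]
  refine (congrFun h k).symm.trans ?_
  refine congrFun (congrArg (mix A₂) (funext fun l => ?_)) k
  rw [← preIterate_sub hA₁]
  exact sub_right_comm _ _ _

/-- The weighted average of the errors moves only by the masked gradients, because the Perron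
vector is preserved by the averaging. -/
lemma centroid_iterate_succ_sub (hA₁ : IsCombinationMatrix nbr A₁)
    (hA₂ : IsCombinationMatrix nbr A₂) {p : Fin N → ℝ} (hpA : (A₁ * A₂).mulVec p = p)
    (wo : Vec M) (i : ℕ) (ω : Ω) :
    centroid p (fun k => iterate nbr A₁ A₂ μ D (i + 1) k ω - wo)
      = centroid p (fun k => iterate nbr A₁ A₂ μ D i k ω - wo)
        - ∑ l, (A₂.mulVec p l * μ l) • maskedGrad nbr A₁ A₂ μ D i l ω := by
  have h1 : (fun k => iterate nbr A₁ A₂ μ D (i + 1) k ω - wo)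
      = mix A₂ (mix A₁ (fun j => iterate nbr A₁ A₂ μ D i j ω - wo)
        - fun l => μ l • maskedGrad nbr A₁ A₂ μ D i l ω) :=
    funext fun k => iterate_succ_sub hA₁ hA₂ wo i k ω
  rw [h1, centroid_mix, map_sub, centroid_mix, Matrix.mulVec_mulVec, hpA]
  simp only [centroid_apply, smul_smul]

lemma measurable_past_iterate (i : ℕ) (k : Fin N) :
    Measurable[past nbr A₁ A₂ μ D i] (iterate nbr A₁ A₂ μ D i k) := by
  refine (comap_measurable _).mono (le_trans ?_ le_sup_left) le_rfl
  exact le_iSup_of_le i (le_iSup₂_of_le le_rfl k le_rfl)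

lemma measurable_mix_apply {𝓕 : MeasurableSpace Ω} {w : Fin N → Ω → Vec M}
    (hw : ∀ j, Measurable[𝓕] (w j)) (l : Fin N) :
    Measurable[𝓕] (fun ω => mix A (fun j => w j ω) l) := by
  simp only [mix_apply]
  exact Finset.measurable_fun_sum _ fun j _ => (hw j).const_smul (A j l)

variable [m0 : MeasurableSpace Ω] {P : Measure Ω}

lemma memLp_mix_apply {w : Fin N → Ω → Vec M} (hw : ∀ j, MemLp (w j) 4 P) (l : Fin N) :
    MemLp (fun ω => mix A (fun j => w j ω) l) 4 P := by
  simp only [mix_apply]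
  exact memLp_finsetSum _ fun j _ => (hw j).const_smul (A j l)

lemma measurable_maskedGrad (hreg : IsRegular P D) {i : ℕ}
    (hw : ∀ k, Measurable (iterate nbr A₁ A₂ μ D i k)) (l : Fin N) :
    Measurable (maskedGrad nbr A₁ A₂ μ D i l) :=
  measurable_mask (hreg.measurable_indicator l i)
    (measurable_approxGrad hreg (measurable_mix_apply hw l))

lemma measurable_iterate (hA₁ : IsCombinationMatrix nbr A₁) (hA₂ : IsCombinationMatrix nbr A₂)
    (hreg : IsRegular P D) (i : ℕ) (k : Fin N) : Measurable (iterate nbr A₁ A₂ μ D i k) := by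
  induction i generalizing k with
  | zero => exact hreg.measurable_init k
  | succ i ih =>
    rw [show iterate nbr A₁ A₂ μ D (i + 1) k = _ from funext (iterate_succ hA₁ hA₂ i k)]
    exact measurable_mix_apply (fun l => (measurable_mix_apply ih l).sub
      ((measurable_maskedGrad hreg ih l).const_smul (μ l))) k

lemma past_le (hA₁ : IsCombinationMatrix nbr A₁) (hA₂ : IsCombinationMatrix nbr A₂)
    (hreg : IsRegular P D) (i : ℕ) : past nbr A₁ A₂ μ D i ≤ m0 :=
  sup_le
    (iSup_le fun j => iSup₂_le fun _ k => (measurable_iterate hA₁ hA₂ hreg j k).comap_le)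
    (iSup_le fun j => iSup₂_le fun _ k => iSup_le fun m =>
      (hreg.measurable_indicator k j m).comap_le)

lemma isIterate_preIterate {i : ℕ} (hw : ∀ k, MemLp (iterate nbr A₁ A₂ μ D i k) 4 P)
    (l : Fin N) : IsIterate P (past nbr A₁ A₂ μ D i) (preIterate nbr A₁ A₂ μ D i l) where
  measurable := measurable_mix_apply (fun j => measurable_past_iterate i j) l
  memLp := memLp_mix_apply hw l

variable {J : Fin N → Vec M → ℝ} {ν δ : ℝ} {wo : Vec M} {r β σ : Fin N → ℝ}
  [IsProbabilityMeasure P]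

lemma memLp_maskedGrad (hA₁ : IsCombinationMatrix nbr A₁) (hA₂ : IsCombinationMatrix nbr A₂)
    (hreg : IsRegular P D) (hI : IndicatorConditions P r (past nbr A₁ A₂ μ D) D)
    (hN : NoiseConditions P J β σ (past nbr A₁ A₂ μ D) D)
    (hJ : ∀ k, HasHessianBounds ν δ (J k)) (hν : 0 ≤ ν) (hδ : 0 ≤ δ)
    (hwo : ∀ k v, J k wo ≤ J k v) {i : ℕ} (hw : ∀ k, MemLp (iterate nbr A₁ A₂ μ D i k) 4 P)
    (l : Fin N) : MemLp (maskedGrad nbr A₁ A₂ μ D i l) 4 P :=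
  memLp_mask (hreg.measurable_indicator l i) (hI.zero_or_one l i)
    (measurable_approxGrad hreg
      (measurable_mix_apply (measurable_iterate hA₁ hA₂ hreg i) l))
    (memLp_approxGrad hN (hJ l) hν hδ (hwo l) (isIterate_preIterate hw l))

lemma memLp_iterate (hA₁ : IsCombinationMatrix nbr A₁) (hA₂ : IsCombinationMatrix nbr A₂)
    (hreg : IsRegular P D) (hI : IndicatorConditions P r (past nbr A₁ A₂ μ D) D)
    (hN : NoiseConditions P J β σ (past nbr A₁ A₂ μ D) D)
    (hJ : ∀ k, HasHessianBounds ν δ (J k)) (hν : 0 ≤ ν) (hδ : 0 ≤ δ)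
    (hwo : ∀ k v, J k wo ≤ J k v) (i : ℕ) (k : Fin N) :
    MemLp (iterate nbr A₁ A₂ μ D i k) 4 P := by
  induction i generalizing k with
  | zero => exact hreg.memLp_init k
  | succ i ih =>
    rw [show iterate nbr A₁ A₂ μ D (i + 1) k = _ from funext (iterate_succ hA₁ hA₂ i k)]
    exact memLp_mix_apply (fun l => (memLp_mix_apply ih l).sub
      ((memLp_maskedGrad hA₁ hA₂ hreg hI hN hJ hν hδ hwo ih l).const_smul (μ l))) k

end Iterates

section Moments

variable {Ω : Type*} {m0 : MeasurableSpace Ω} {P : Measure Ω} {E : Type*} [NormedAddCommGroup E]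

lemma lintegral_enorm_pow_four {f : Ω → E} (hf : MemLp f 4 P) :
    ∫⁻ ω, ‖f ω‖ₑ ^ 4 ∂P = ENNReal.ofReal (lpNorm f 4 P ^ 4) := by
  rw [lpNorm_four_pow hf, ofReal_integral_eq_lintegral_ofReal (integrable_norm_pow_four hf)
    (Eventually.of_forall fun ω => by positivity)]
  refine lintegral_congr fun ω => ?_
  rw [ENNReal.ofReal_pow (norm_nonneg _), ofReal_norm]

lemma lintegral_enorm_sq_le [IsProbabilityMeasure P] {f : Ω → E} (hf : MemLp f 4 P) :
    ∫⁻ ω, ‖f ω‖ₑ ^ 2 ∂P ≤ ENNReal.ofReal (lpNorm f 4 P ^ 2) := by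
  have h2 : ∫⁻ ω, ‖f ω‖ₑ ^ 2 ∂P = eLpNorm f 2 P ^ 2 := by
    have := eLpNorm_nnreal_pow_eq_lintegral (f := f) (μ := P) (p := 2) (by norm_num)
    simpa using this.symm
  rw [h2, ENNReal.ofReal_pow lpNorm_nonneg, ofReal_lpNorm hf]
  gcongr
  exact eLpNorm_le_eLpNorm_of_exponent_le (by norm_num) hf.1

end Moments

end CoordDiffusion

/-! ### Stability of the network in the mean-square and fourth-order sense -/

theorem theorem1 (N M : ℕ)
    -- the network and its combination matrices
    (nbr : Fin N → Finset (Fin N)) (hnbr : CoordDiffusion.IsStronglyConnected nbr)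
    (A₁ A₂ : Matrix (Fin N) (Fin N) ℝ)
    (hA₁ : CoordDiffusion.IsCombinationMatrix nbr A₁)
    (hA₂ : CoordDiffusion.IsCombinationMatrix nbr A₂)
    (hP : (A₁ * A₂).IsPrimitive)
    -- the costs and their common minimizer
    (J : Fin N → CoordDiffusion.Vec M → ℝ) (ν δ : ℝ) (hν : 0 < ν) (hνδ : ν ≤ δ)
    (hJ : ∀ k, CoordDiffusion.HasHessianBounds ν δ (J k))
    (wo : CoordDiffusion.Vec M) (hwo : ∀ k w, J k wo ≤ J k w)
    -- the missing probabilities and the noise parameters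
    (r : Fin N → ℝ) (hr : ∀ k, 0 ≤ r k ∧ r k < 1)
    (β σ : Fin N → ℝ) (hβ : ∀ k, 0 ≤ β k) (hσ : ∀ k, 0 ≤ σ k) :
    ∃ C μo : ℝ, 0 < C ∧ 0 < μo ∧
      ∀ μ : Fin N → ℝ, (∀ k, 0 < μ k) → (⨆ k, μ k) < μo →
      ∀ (Ω : Type*) [MeasurableSpace Ω] (P : Measure Ω) [IsProbabilityMeasure P]
        (D : CoordDiffusion.Inputs N M Ω),
        CoordDiffusion.IsRegular P D →
        CoordDiffusion.IndicatorConditions P r (CoordDiffusion.past nbr A₁ A₂ μ D) D →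
        CoordDiffusion.NoiseConditions P J β σ (CoordDiffusion.past nbr A₁ A₂ μ D) D →
        ∀ k : Fin N,
          limsup (fun i : ℕ =>
              ∫⁻ ω, ‖wo - CoordDiffusion.iterate nbr A₁ A₂ μ D i k ω‖ₑ ^ 2 ∂P) atTop
            ≤ ENNReal.ofReal (C * ⨆ k, μ k) ∧
          limsup (fun i : ℕ =>
              ∫⁻ ω, ‖wo - CoordDiffusion.iterate nbr A₁ A₂ μ D i k ω‖ₑ ^ 4 ∂P) atTop
            ≤ ENNReal.ofReal (C * (⨆ k, μ k) ^ 2) := by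
  open CoordDiffusion in
  obtain ⟨k₀, -⟩ := hnbr.selfLoop
  have : Nonempty (Fin N) := ⟨k₀⟩
  have hS₁ := hA₁.isLeftStochastic
  have hS₂ := hA₂.isLeftStochastic
  have hδ : 0 < δ := hν.trans_le hνδ
  obtain ⟨p, hp0, hp, hpA⟩ := exists_perron_vector (hS₁.mul hS₂) hP
  have hq0 : ∀ l, 0 ≤ A₂.mulVec p l := fun l => by
    simp only [Matrix.mulVec, dotProduct]
    exact Finset.sum_nonneg fun j _ => mul_nonneg (hS₂.nonneg l j) (hp0 j).le
  have hq : ∑ l, A₂.mulVec p l = 1 := (hS₂.sum_mulVec p).trans hp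
  obtain ⟨k₁, -, hk₁⟩ := Finset.exists_min_image Finset.univ (fun k => 1 - r k)
    Finset.univ_nonempty
  set ρ : ℝ := 1 - r k₁
  have hρ : 0 < ρ := by linarith [(hr k₁).2]
  have hrρ : ∀ l, ρ ≤ 1 - r l := fun l => hk₁ l (Finset.mem_univ l)
  -- A common bound for the size of the approximate gradients and of their means.
  set L : ℝ := 2 * δ + ∑ l, (β l + β l * ‖wo‖ + σ l)
  have hLterm : ∀ l, 0 ≤ β l + β l * ‖wo‖ + σ l := fun l =>
    add_nonneg (add_nonneg (hβ l) (mul_nonneg (hβ l) (norm_nonneg _))) (hσ l)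
  have hLl : ∀ l, 2 * δ + (β l + β l * ‖wo‖ + σ l) ≤ L := fun l => by
    have := Finset.single_le_sum (f := fun l => β l + β l * ‖wo‖ + σ l) (fun l _ => hLterm l)
      (Finset.mem_univ l)
    linarith
  have hL : 0 ≤ L := add_nonneg (by positivity) (Finset.sum_nonneg fun l _ => hLterm l)
  obtain ⟨C, s₀, hC, hs₀, H⟩ := exists_eventually_norm_sq_le hS₁ hS₂ hP hp0 hp hpA
    (κ := ρ * ν / 2) (δ := δ) (L := L) (by positivity) hδ.le hL
  refine ⟨C + C ^ 2, min s₀ (min (1 / (ρ * ν / 2)) (ρ * ν / δ ^ 2)), by positivity,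
    lt_min hs₀ (lt_min (by positivity) (by positivity)), ?_⟩
  intro μ hμ hμo Ω _ P _ D hreg hI hN
  set μmax := ⨆ k, μ k
  have hle : ∀ k, μ k ≤ μmax := fun k => le_ciSup (Finite.bddAbove_range μ) k
  have hμmax0 : 0 < μmax := (hμ k₀).trans_le (hle k₀)
  -- The weighted step size `s = ∑ u` governs both the drift and the noise. It is positive and at
  -- most `μmax`, whatever the ratios of the individual step sizes.
  set u : Fin N → ℝ := fun l => A₂.mulVec p l * μ l
  have hu : ∀ l, 0 ≤ u l := fun l => mul_nonneg (hq0 l) (hμ l).le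
  set s : ℝ := ∑ l, u l
  have hsμ : s ≤ μmax := by
    calc s ≤ ∑ l, A₂.mulVec p l * μmax :=
          Finset.sum_le_sum fun l _ => mul_le_mul_of_nonneg_left (hle l) (hq0 l)
      _ = μmax := by rw [← Finset.sum_mul, hq, one_mul]
  have hs0 : 0 < s := by
    obtain ⟨l, -, hl⟩ := Finset.exists_ne_zero_of_sum_ne_zero (hq.trans_ne one_ne_zero)
    exact Finset.sum_pos' (fun l _ => hu l)
      ⟨l, Finset.mem_univ l, mul_pos ((hq0 l).lt_of_ne' hl) (hμ l)⟩
  obtain ⟨hb0, hb1, hb2⟩ : s < s₀ ∧ s < 1 / (ρ * ν / 2) ∧ s < ρ * ν / δ ^ 2 := by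
    simpa [lt_min_iff] using hsμ.trans_lt hμo
  have hs1 : ρ * ν / 2 * s ≤ 1 := by
    rw [lt_div_iff₀ (by positivity)] at hb1
    linarith
  have hs2 : δ ^ 2 * s ≤ ρ * ν := by
    rw [lt_div_iff₀ (by positivity)] at hb2
    linarith
  set w := iterate nbr A₁ A₂ μ D
  have hw4 : ∀ i k, MemLp (w i k) 4 P :=
    memLp_iterate hA₁ hA₂ hreg hI hN hJ hν.le hδ.le hwo
  have he4 : ∀ i k, MemLp (fun ω => w i k ω - wo) 4 P := fun i k => memLp_sub_const (hw4 i k)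
  have hg4 : ∀ i k, MemLp (maskedGrad nbr A₁ A₂ μ D i k) 4 P := fun i =>
    memLp_maskedGrad hA₁ hA₂ hreg hI hN hJ hν.le hδ.le hwo (hw4 i)
  have hφ : ∀ i l, IsIterate P (past nbr A₁ A₂ μ D i) (preIterate nbr A₁ A₂ μ D i l) :=
    fun i => isIterate_preIterate (hw4 i)
  -- The errors `w - wo` and the masked gradients as elements of the normed space `L⁴`.
  have : Fact ((1 : ℝ≥0∞) ≤ 4) := ⟨by norm_num⟩
  set x : ℕ → Fin N → Lp (Vec M) 4 P := fun i k => (he4 i k).toLp _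
  set g : ℕ → Fin N → Lp (Vec M) 4 P := fun i k => (hg4 i k).toLp _
  -- Relations between the random vectors of one iteration, transferred to `L⁴`.
  have hφ4 : ∀ i l, MemLp (fun ω => preIterate nbr A₁ A₂ μ D i l ω - wo) 4 P := fun i l =>
    memLp_sub_const (hφ i l).memLp
  have hφx : ∀ i l, (hφ4 i l).toLp _ = mix A₁ (x i) l := fun i l => by
    have h4 : MemLp (fun ω => ∑ j, A₁ j l • (w i j ω - wo)) 4 P :=
      memLp_mix_apply (A := A₁) (he4 i) l
    refine Eq.trans ?_ (toLp_sum_smul Finset.univ (fun j => A₁ j l) (he4 i) h4)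
    exact MemLp.toLp_congr _ _ (Eventually.of_forall fun ω => preIterate_sub hA₁ wo i l ω)
  set c : ℕ → Ω → Vec M := fun i ω => centroid p (fun k => w i k ω - wo) with hc_def
  have hc4 : ∀ i, MemLp (c i) 4 P := fun i => by
    simp only [hc_def, centroid_apply]
    exact memLp_finsetSum _ fun k _ => (he4 i k).const_smul (p k)
  have hcx : ∀ i, (hc4 i).toLp _ = centroid p (x i) := fun i =>
    toLp_sum_smul Finset.univ p (he4 i) (hc4 i)
  have hcnorm : ∀ i, lpNorm (c i) 4 P = ‖centroid p (x i)‖ := fun i => by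
    rw [← hcx, norm_toLp_eq_lpNorm]
  have hφnorm : ∀ i l, lpNorm (fun ω => preIterate nbr A₁ A₂ μ D i l ω - wo) 4 P ≤ ‖x i‖ :=
    fun i l => by
      rw [← norm_toLp_eq_lpNorm (hφ4 i l), hφx]
      exact (norm_le_pi_norm _ l).trans (norm_mix_le hS₁ (x i))
  have hdnorm : ∀ i l, lpNorm (fun ω => preIterate nbr A₁ A₂ μ D i l ω - wo - c i ω) 4 P
      ≤ ‖deviation p (x i)‖ := fun i l => by
    have h1 : ‖((hφ4 i l).sub (hc4 i)).toLp _‖ ≤ ‖deviation p (x i)‖ := by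
      have h2 : mix A₁ (deviation p (x i)) l = mix A₁ (x i) l - centroid p (x i) := by
        rw [deviation_apply, map_sub, mix_const hS₁]
        rfl
      rw [MemLp.toLp_sub (hφ4 i l) (hc4 i), hφx, hcx, ← h2]
      exact (norm_le_pi_norm _ l).trans (norm_mix_le hS₁ _)
    rwa [norm_toLp_eq_lpNorm] at h1
  have hBL : ∀ i l, lpNorm (fun ω => D.approxGrad l i (preIterate nbr A₁ A₂ μ D i l ω) ω) 4 P
      + lpNorm (fun ω => gradient (J l) (preIterate nbr A₁ A₂ μ D i l ω)) 4 P
      ≤ L * (‖x i‖ + 1) := fun i l => by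
    have h1 := lpNorm_approxGrad_le (past_le hA₁ hA₂ hreg i) hN (hJ l) hν.le hδ.le (hwo l)
      (hβ l) (hσ l) (hφ i l)
    have h2 := lpNorm_gradient_le (hJ l) hν.le hδ.le (hwo l) (hφ i l).memLp
    have h3 := hφnorm i l
    have h4 : (2 * δ + β l) * lpNorm (fun ω => preIterate nbr A₁ A₂ μ D i l ω - wo) 4 P
        ≤ (2 * δ + β l) * ‖x i‖ :=
      mul_le_mul_of_nonneg_left h3 (by linarith [hβ l])
    have h5 := mul_le_mul_of_nonneg_right (hLl l) (by positivity : 0 ≤ ‖x i‖ + 1)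
    have h6 : 0 ≤ (β l * ‖wo‖ + σ l) * ‖x i‖ := mul_nonneg
      (add_nonneg (mul_nonneg (hβ l) (norm_nonneg _)) (hσ l)) (norm_nonneg _)
    linarith [hβ l]
  have hrec : ∀ i, x (i + 1) = mix A₂ (mix A₁ (x i) - fun l => μ l • g i l) := fun i => by
    ext1 k
    have hψ : ∀ l, MemLp (fun ω => mix A₁ (fun j => w i j ω - wo) l
        - μ l • maskedGrad nbr A₁ A₂ μ D i l ω) 4 P := fun l =>
      (memLp_mix_apply (he4 i) l).sub ((hg4 i l).const_smul (μ l))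
    have h4 : MemLp (fun ω => ∑ l, A₂ l k • (mix A₁ (fun j => w i j ω - wo) l
        - μ l • maskedGrad nbr A₁ A₂ μ D i l ω)) 4 P := memLp_mix_apply (A := A₂) hψ k
    have h5 : x (i + 1) k = h4.toLp _ :=
      MemLp.toLp_congr _ _ (Eventually.of_forall fun ω => iterate_succ_sub hA₁ hA₂ wo i k ω)
    rw [h5, toLp_sum_smul Finset.univ (fun l => A₂ l k) hψ h4, mix_apply]
    refine Finset.sum_congr rfl fun l _ => ?_
    congr 1
    have h6 : (hψ l).toLp _ = ((hφ4 i l).sub ((hg4 i l).const_smul (μ l))).toLp _ :=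
      MemLp.toLp_congr _ _ (Eventually.of_forall fun ω => by
        simp only [Pi.sub_apply, Pi.smul_apply]
        rw [preIterate_sub hA₁])
    rw [h6, MemLp.toLp_sub (hφ4 i l) ((hg4 i l).const_smul (μ l)), MemLp.toLp_const_smul, hφx]
    rfl
  have hgL : ∀ i, ‖g i‖ ≤ L * (‖x i‖ + 1) := fun i => by
    refine (pi_norm_le_iff_of_nonneg (by positivity)).mpr fun l => ?_
    rw [norm_toLp_eq_lpNorm]
    have h1 : lpNorm (maskedGrad nbr A₁ A₂ μ D i l) 4 P
        ≤ 1 * lpNorm (fun ω => D.approxGrad l i (preIterate nbr A₁ A₂ μ D i l ω) ω) 4 P :=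
      lpNorm_le_mul_of_norm_le zero_le_one
        (memLp_approxGrad hN (hJ l) hν.le hδ.le (hwo l) (hφ i l)) fun ω => by
          rw [one_mul]
          exact norm_mask_le (fun m => hI.zero_or_one l i m ω) _
    have h2 : 0 ≤ lpNorm (fun ω => gradient (J l) (preIterate nbr A₁ A₂ μ D i l ω)) 4 P :=
      lpNorm_nonneg
    linarith [hBL i l]
  have hcrec : ∀ i, ‖centroid p (x (i + 1))‖ ^ 2
      ≤ ((1 - ρ * ν / 2 * s) * ‖centroid p (x i)‖ + δ * s * ‖deviation p (x i)‖) ^ 2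
        + 4 * (s * (L * (‖x i‖ + 1))) ^ 2 := fun i => by
    have hcI : IsIterate P (past nbr A₁ A₂ μ D i) (c i) :=
      ⟨by
        simp only [hc_def, centroid_apply]
        exact Finset.measurable_fun_sum _ fun k _ =>
          ((measurable_past_iterate i k).sub_const wo).const_smul (p k), hc4 i⟩
    have h := lpNorm_centroid_step_sq_le (past_le hA₁ hA₂ hreg i) hreg hI hN hJ hν.le hδ.le hwo
      hρ.le (fun l => (hr l).1) hrρ hu hs1 hs2 (hφ i) hcI (hBL i) (hdnorm i)
    have hnext : c (i + 1) = fun ω => c i ω - ∑ l, u l • maskedGrad nbr A₁ A₂ μ D i l ω :=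
      funext fun ω => centroid_iterate_succ_sub hA₁ hA₂ hpA wo i ω
    rw [← hcnorm, ← hcnorm, hnext]
    exact h
  have hfinal := H (Lp (Vec M) 4 P) μ s (fun l => (hμ l).le) rfl hs0 hb0 x g hrec hgL hcrec
  intro k
  have hev : ∀ᶠ i in atTop, lpNorm (fun ω => wo - w i k ω) 4 P ^ 2 ≤ C * μmax := by
    filter_upwards [hfinal] with i hi
    have h1 : lpNorm (fun ω => wo - w i k ω) 4 P = ‖x i k‖ := by
      rw [norm_toLp_eq_lpNorm]
      exact lpNorm_sub_comm (fun _ => wo) (w i k) 4 P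
    rw [h1]
    exact (pow_le_pow_left₀ (norm_nonneg _) (norm_le_pi_norm (x i) k) 2).trans
      (hi.trans (mul_le_mul_of_nonneg_left hsμ hC.le))
  have hm4 : ∀ i, MemLp (fun ω => wo - w i k ω) 4 P := fun i => (memLp_const wo).sub (hw4 i k)
  -- `‖wo - w‖² ≤ C μmax` in `L⁴` bounds the second moment directly, and by squaring the fourth.
  constructor
  · refine limsup_le_of_le (h := ?_)
    filter_upwards [hev] with i hi
    refine (lintegral_enorm_sq_le (hm4 i)).trans (ENNReal.ofReal_le_ofReal (hi.trans ?_))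
    nlinarith [mul_pos (pow_pos hC 2) hμmax0]
  · refine limsup_le_of_le (h := ?_)
    filter_upwards [hev] with i hi
    rw [lintegral_enorm_pow_four (hm4 i)]
    refine ENNReal.ofReal_le_ofReal ?_
    have h2 := pow_le_pow_left₀ (sq_nonneg _) hi 2
    nlinarith [mul_pos hC (pow_pos hμmax0 2)]
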